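/- **Problem (robust multi-period ordering with predictions under changing costs).** An instance $\mathcal V$ consists of a number $T\ge 1$ of preparation days, a number $K\ge 1$ of phases, integers $1=\tau_0<\tau_1<\dots<\tau_K=T+1$ (phase $v$ consists of the days $\tau_{v-1},\dots,\tau_v-1$), real unit costs $0<\gamma_1\le\gamma_2\le\dots\le\gamma_K<p$, where $p$ is the unit revenue, an initial demand interval $[\underline d_0,\overline d_0]$ with $0\le\underline d_0\le\overline d_0$, prediction error bounds $\triangle_1,\dots,\triangle_T\ge 0$ and supply capacities $V_1,\dots,V_T\ge 0$. The cost $c_t$ of day $t$ is $\gamma_v$ if $t$ is in phase $v$. A regular prediction sequence $\mathcal P$ for a demand $d$ consists of intervals $[\underline d_0,\overline d_0]\supseteq[\underline d_1,\overline d_1]\supseteq\dots\supseteq[\underline d_T,\overline d_T]\ni d$ with $0\le \overline d_t-\underline d_t\le\triangle_t$ for $1\le t\le T$. A policy $\pi=(\pi_1,\dots,\pi_T)$ chooses on each day $t$ the order $a_t=\pi_t([\underline d_t,\overline d_t],x_t)\in[0,V_t]$, where the $v$-th coordinate of $x_t\in\mathbb R^K$ is the amount ordered in phase $v$ before day $t$.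 Its profit is $$\mathcal R_\pi(\mathcal P,d)=p\min\Bigl(d,\sum_{t=1}^T a_t\Bigr)-\sum_{t=1}^T c_ta_t ,$$ and $\mathcal R^\sharp(d)$ denotes the hindsight optimal profit, the maximum of $p\min(d,\sum_t a_t)-\sum_t c_ta_t$ over all $a\in\prod_t[0,V_t]$. The competitive ratio is $\varphi_\pi(\mathcal P,d)=\mathcal R_\pi(\mathcal P,d)/\mathcal R^\sharp(d)$ if $\mathcal R^\sharp(d)>0$; if $\mathcal R^\sharp(d)=0$, it is $1$ when $\mathcal R_\pi(\mathcal P,d)=0$ and $-\infty$ when $\mathcal R_\pi(\mathcal P,d)<0$. Let $$\Phi^*=\sup_\pi\inf_{\mathcal P,d}\varphi_\pi(\mathcal P,d),\qquad \zeta=\max\Bigl(\ln\frac{p-\gamma_1}{p-\gamma_K},\ \ln\frac{\gamma_K}{\gamma_1}\Bigr).$$ **Proposition.** There is a single algorithm (a program of a real RAM: unit-cost real arithmetic without rounding, unit-cost comparisons and array access, unit-cost addition and subtraction of natural numbers) and a universal constant $C$ such that, for every instance $\mathcal V$ and every real $\varepsilon>0$, the algorithm on input $(\mathcal V,\varepsilon)$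 halts after at most $$\max(T,2)^{\,C\cdot\max(1,\ \zeta/\varepsilon)}$$ steps and outputs a real number $\Phi$ with $|\Phi-\Phi^*|\le\varepsilon$; in particular $\Phi^*$ is finite. (For $T\ge2$ and $\zeta\ge\varepsilon$ this is a running time of $T^{O(\zeta/\varepsilon)}$.) -/

import Mathlib

/-! ### Robust multi-period ordering with predictions under changing costs -/

/-- An instance: `T` preparation days `1, …, T`, divided into `K` phases by the grid
`1 = τ 0 < τ 1 < ⋯ < τ K = T + 1`; phase `v ∈ {1, …, K}` consists of the days
`τ (v - 1), …, τ v - 1` and has unit ordering cost `γ v`.  The initial demand interval is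
`[dlo, dhi]`, `Δ t` is the prediction error bound and `V t` the supply capacity of day `t`, and
`p` is the unit revenue.  Only `τ 0, …, τ K`, `γ 1, …, γ K`, `Δ 1, …, Δ T` and `V 1, …, V T` are
data of the instance; no other value of these functions is ever used. -/
structure OrderingInstance where
  T : ℕ
  K : ℕ
  τ : ℕ → ℕ
  dlo : ℝ
  dhi : ℝ
  Δ : ℕ → ℝ
  γ : ℕ → ℝ
  p : ℝ
  V : ℕ → ℝ
  one_le_K : 1 ≤ K
  τ_zero : τ 0 = 1
  τ_last : τ K = T + 1
  τ_lt : ∀ v < K, τ v < τ (v + 1)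
  dlo_nonneg : 0 ≤ dlo
  dlo_le_dhi : dlo ≤ dhi
  Δ_nonneg : ∀ t, 1 ≤ t → t ≤ T → 0 ≤ Δ t
  V_nonneg : ∀ t, 1 ≤ t → t ≤ T → 0 ≤ V t
  γ_pos : 0 < γ 1
  γ_mono : ∀ v, 1 ≤ v → v < K → γ v ≤ γ (v + 1)
  γ_lt_p : γ K < p

namespace OrderingInstance

/-- Day `t` belongs to phase `v + 1`. -/
abbrev InPhase (I : OrderingInstance) (v t : ℕ) : Prop := I.τ v ≤ t ∧ t < I.τ (v + 1)

/-- The unit ordering cost `c t` of day `t`. -/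
noncomputable def unitCost (I : OrderingInstance) (t : ℕ) : ℝ :=
  ∑ v ∈ Finset.range I.K, if I.InPhase v t then I.γ (v + 1) else 0

/-- The profit of ordering `a t` on each day `t ∈ {1, …, T}` when the demand is `d`. -/
noncomputable def profit (I : OrderingInstance) (a : ℕ → ℝ) (d : ℝ) : ℝ :=
  I.p * min d (∑ t ∈ Finset.Icc 1 I.T, a t) - ∑ t ∈ Finset.Icc 1 I.T, I.unitCost t * a t

/-- The hindsight optimal profit: the best profit of an order plan that respects the supply
capacities and may depend on `d`. -/
noncomputable def hindsight (I : OrderingInstance) (d : ℝ) : ℝ :=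
  sSup {r | ∃ a : ℕ → ℝ, (∀ t, 1 ≤ t → t ≤ I.T → 0 ≤ a t ∧ a t ≤ I.V t) ∧ r = I.profit a d}

/-- A policy: `order t a b x` is the quantity ordered on day `t` on seeing the prediction interval
`[a, b]` at the inventory vector `x`; the coordinate `x v` is the amount ordered so far in
phase `v + 1`. -/
structure Policy (I : OrderingInstance) where
  order : ℕ → ℝ → ℝ → (Fin I.K → ℝ) → ℝ
  order_mem : ∀ t, 1 ≤ t → t ≤ I.T → ∀ a b x, 0 ≤ b - a → b - a ≤ I.Δ t →
    0 ≤ order t a b x ∧ order t a b x ≤ I.V t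

/-- `[lo t, hi t]`, `1 ≤ t ≤ T`, is a regular prediction sequence for the demand `d`.
The interval of day `0` is `[dlo, dhi]`. -/
structure IsRegular (I : OrderingInstance) (lo hi : ℕ → ℝ) (d : ℝ) : Prop where
  lo_zero : lo 0 = I.dlo
  hi_zero : hi 0 = I.dhi
  le : ∀ t, 1 ≤ t → t ≤ I.T → lo t ≤ hi t
  nested : ∀ t, 1 ≤ t → t ≤ I.T → lo (t - 1) ≤ lo t ∧ hi t ≤ hi (t - 1)
  error : ∀ t, 1 ≤ t → t ≤ I.T → hi t - lo t ≤ I.Δ t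
  demand : lo I.T ≤ d ∧ d ≤ hi I.T

variable {I : OrderingInstance}

/-- The inventory vector after the orders of the days `1, …, n`. -/
noncomputable def Policy.inventory (π : Policy I) (lo hi : ℕ → ℝ) : ℕ → Fin I.K → ℝ
  | 0 => fun _ => 0
  | n + 1 => fun v => π.inventory lo hi n v +
      if I.InPhase v (n + 1) then
        π.order (n + 1) (lo (n + 1)) (hi (n + 1)) (π.inventory lo hi n) else 0

/-- The quantity ordered on day `t ≥ 1` along a prediction sequence. -/
noncomputable def Policy.action (π : Policy I) (lo hi : ℕ → ℝ) (t : ℕ) : ℝ :=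
  π.order t (lo t) (hi t) (π.inventory lo hi (t - 1))

/-- The competitive ratio of a policy along a prediction sequence and a demand.  If the hindsight
optimum is `0`, then the ratio is `1` when the policy attains it and `-∞` when it does not. -/
noncomputable def Policy.ratio (π : Policy I) (lo hi : ℕ → ℝ) (d : ℝ) : EReal :=
  if I.hindsight d = 0 then
    (if I.profit (π.action lo hi) d < 0 then ⊥ else 1)
  else ((I.profit (π.action lo hi) d / I.hindsight d : ℝ) : EReal)

/-- The robust competitive ratio of a policy. -/
noncomputable def Policy.robustRatio (π : Policy I) : EReal :=
  ⨅ (lo : ℕ → ℝ) (hi : ℕ → ℝ) (d : ℝ) (_ : I.IsRegular lo hi d), π.ratio lo hi d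

/-- The optimal robust competitive ratio `Φ*`. -/
noncomputable def optimalRatio (I : OrderingInstance) : EReal :=
  ⨆ π : Policy I, π.robustRatio

/-- `ζ = max (ln ((p - γ₁) / (p - γ_K))) (ln (γ_K / γ₁))`. -/
noncomputable def zeta (I : OrderingInstance) : ℝ :=
  max (Real.log ((I.p - I.γ 1) / (I.p - I.γ I.K))) (Real.log (I.γ I.K / I.γ 1))

end OrderingInstance

/-! ### The real RAM

Programs act on unbounded arrays of natural numbers and on unbounded arrays of real numbers.
Every arithmetic operation, comparison, memory access and constant costs one step.  Addresses are
natural numbers; a real number is never converted into a natural number, and the only real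
constants of a program are rational. -/

namespace RealRAM

/-- A memory state: `ints A i` is cell `i` of the `A`-th array of natural numbers, `reals A i` is
cell `i` of the `A`-th array of real numbers. -/
structure State where
  ints : ℕ → ℕ → ℕ
  reals : ℕ → ℕ → ℝ

/-- Expressions with values in the natural numbers (`sub` is truncated subtraction). -/
inductive IntExpr : Type
  | const (n : ℕ)
  | read (A : ℕ) (i : IntExpr)
  | add (e f : IntExpr)
  | sub (e f : IntExpr)

/-- Expressions with values in the real numbers (a quotient by `0` is `0`). -/
inductive RealExpr : Type
  | const (q : ℚ)
  | read (A : ℕ) (i : IntExpr)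
  | add (e f : RealExpr)
  | sub (e f : RealExpr)
  | mul (e f : RealExpr)
  | div (e f : RealExpr)

/-- Tests. -/
inductive Test : Type
  | intLe (e f : IntExpr)
  | realLe (e f : RealExpr)
  | not (b : Test)
  | and (b c : Test)

/-- Programs. -/
inductive Program : Type
  | skip
  | writeInt (A : ℕ) (i e : IntExpr)
  | writeReal (A : ℕ) (i : IntExpr) (e : RealExpr)
  | seq (P Q : Program)
  | cond (b : Test) (P Q : Program)
  | loop (b : Test) (P : Program)

def IntExpr.eval (s : State) : IntExpr → ℕ
  | .const n => n
  | .read A i => s.ints A (i.eval s)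
  | .add e f => e.eval s + f.eval s
  | .sub e f => e.eval s - f.eval s

def IntExpr.cost : IntExpr → ℕ
  | .const _ => 1
  | .read _ i => i.cost + 1
  | .add e f => e.cost + f.cost + 1
  | .sub e f => e.cost + f.cost + 1

noncomputable def RealExpr.eval (s : State) : RealExpr → ℝ
  | .const q => q
  | .read A i => s.reals A (i.eval s)
  | .add e f => e.eval s + f.eval s
  | .sub e f => e.eval s - f.eval s
  | .mul e f => e.eval s * f.eval s
  | .div e f => e.eval s / f.eval s

def RealExpr.cost : RealExpr → ℕ
  | .const _ => 1
  | .read _ i => i.cost + 1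
  | .add e f => e.cost + f.cost + 1
  | .sub e f => e.cost + f.cost + 1
  | .mul e f => e.cost + f.cost + 1
  | .div e f => e.cost + f.cost + 1

def Test.Holds (s : State) : Test → Prop
  | .intLe e f => e.eval s ≤ f.eval s
  | .realLe e f => e.eval s ≤ f.eval s
  | .not b => ¬ b.Holds s
  | .and b c => b.Holds s ∧ c.Holds s

def Test.cost : Test → ℕ
  | .intLe e f => e.cost + f.cost + 1
  | .realLe e f => e.cost + f.cost + 1
  | .not b => b.cost + 1
  | .and b c => b.cost + c.cost + 1

def State.setInt (s : State) (A i n : ℕ) : State :=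
  { s with ints := Function.update s.ints A (Function.update (s.ints A) i n) }

noncomputable def State.setReal (s : State) (A i : ℕ) (x : ℝ) : State :=
  { s with reals := Function.update s.reals A (Function.update (s.reals A) i x) }

/-- `Runs P s s' n`: started in the state `s`, the program `P` halts in the state `s'` after
exactly `n` steps. -/
inductive Runs : Program → State → State → ℕ → Prop
  | skip (s : State) : Runs .skip s s 1
  | writeInt (s : State) (A : ℕ) (i e : IntExpr) :
      Runs (.writeInt A i e) s (s.setInt A (i.eval s) (e.eval s)) (i.cost + e.cost + 1)
  | writeReal (s : State) (A : ℕ) (i : IntExpr) (e : RealExpr) :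
      Runs (.writeReal A i e) s (s.setReal A (i.eval s) (e.eval s)) (i.cost + e.cost + 1)
  | seq {P Q : Program} {s s' s'' : State} {m n : ℕ} :
      Runs P s s' m → Runs Q s' s'' n → Runs (.seq P Q) s s'' (m + n)
  | condTrue {b : Test} {P Q : Program} {s s' : State} {n : ℕ} :
      b.Holds s → Runs P s s' n → Runs (.cond b P Q) s s' (b.cost + n)
  | condFalse {b : Test} {P Q : Program} {s s' : State} {n : ℕ} :
      ¬ b.Holds s → Runs Q s s' n → Runs (.cond b P Q) s s' (b.cost + n)
  | loopTrue {b : Test} {P : Program} {s s' s'' : State} {m n : ℕ} :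
      b.Holds s → Runs P s s' m → Runs (.loop b P) s' s'' n →
        Runs (.loop b P) s s'' (b.cost + m + n)
  | loopFalse {b : Test} {P : Program} {s : State} :
      ¬ b.Holds s → Runs (.loop b P) s s b.cost

end RealRAM

/-- The initial memory for the instance `I` and the accuracy `ε`.  Array `0` of natural numbers
holds `T, K` and array `1` holds `τ 0, …, τ K`.  Array `0` of real numbers holds
`p, dlo, dhi, ε`; the cells `1, 2, …` of the arrays `1`, `2`, `3` of real numbers hold
`Δ 1, …, Δ T`, `V 1, …, V T` and `γ 1, …, γ K`.  All other cells are `0`. -/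
noncomputable def OrderingInstance.input (I : OrderingInstance) (ε : ℝ) : RealRAM.State where
  ints
    | 0, 0 => I.T
    | 0, 1 => I.K
    | 1, i => if i ≤ I.K then I.τ i else 0
    | _, _ => 0
  reals
    | 0, 0 => I.p
    | 0, 1 => I.dlo
    | 0, 2 => I.dhi
    | 0, 3 => ε
    | 1, i => if 1 ≤ i ∧ i ≤ I.T then I.Δ i else 0
    | 2, i => if 1 ≤ i ∧ i ≤ I.T then I.V i else 0
    | 3, i => if 1 ≤ i ∧ i ≤ I.K then I.γ i else 0
    | _, _ => 0

/-- The output of a computation: cell `0` of array `0` of real numbers. -/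
def RealRAM.State.output (s : RealRAM.State) : ℝ := s.reals 0 0

/-! ### Greedy spending under increasing budgets -/

/-! The optimum can be computed exactly in time `O(T ^ 5)`; the claimed bound follows because its
exponent is at least `C`. Write `R d` for the hindsight profit.

Measure orders in money. A policy that guarantees `φ` must survive the collapse of the prediction on
day `t` to its lower end, which then is the demand; this forces the money spent through day `t` to
be at most the budget `p * lo t - φ * R (lo t)` (`Policy.cost_le_budget`). A unit of money spent on
day `t` buys margin at the rate `(p - c t) / c t`, which does not increase with `t`. By summation by
parts, spending as early as the budgets and capacities allow is therefore best
(`weightedIncrements_mono`, `le_spend`). Since `R` is `p`-Lipschitz, budgets grow with the lower end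
when `φ ≤ 1`. Among the predictions ending with upper end `h`, the worst thus keeps its lower ends
as low as the error bounds permit. Let `slack φ h` be the greedy margin along this sequence minus `φ
* R h`. Then `φ ∈ [0, 1]` can be guaranteed if and only if no slack on `[dlo, dhi]` is negative
(`Policy.slack_nonneg`, `le_profit_greedyPolicy`), and `Φ*` is the largest such `φ`
(`optimalRatio_eq`).

Two finiteness facts make this computable. The greedy margin is concave in any parameter on which
the budgets depend concavely (`concaveOn_gain`). In `h` the budgets are affine between `O(T ^ 2)`
explicit breakpoints, so testing the slack there suffices (`slack_nonneg_of_grid`). For fixed `h`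
the slack is concave in `φ`, nonnegative at `0`, and affine between the `O(T ^ 2)` crossings of the
budget lines (`affineOn_slack_ratio`). Testing all crossings brackets its zero within an affine
piece, where the secant gives it exactly (`le_root_iff`). The answer is the minimum of these zeros,
capped at `1`, over the tested demands.

The program is written in a language of counted loops, whose running time is a constant times `T` to
the nesting depth (`runs_toProgram`), and is verified by loop invariants. -/

namespace RobustOrdering

open Finset

/-- The greedy cumulative spending under the budgets `B` and the daily caps `k`. -/
noncomputable def spend (B k : ℕ → ℝ) : ℕ → ℝ
  | 0 => 0
  | n + 1 => min (B (n + 1)) (spend B k n + k (n + 1))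

/-- The sum of the increments of `X` over the days `1, …, n`, weighted by `e`. -/
noncomputable def weightedIncrements (e X : ℕ → ℝ) (n : ℕ) : ℝ :=
  ∑ i ∈ range n, e (i + 1) * (X (i + 1) - X i)

/-- The weighted increments of the greedy spending. -/
noncomputable def gain (e B k : ℕ → ℝ) (n : ℕ) : ℝ :=
  weightedIncrements e (spend B k) n

/-- Partial sums over the days `1, …, n`. -/
noncomputable def partialSum (k : ℕ → ℝ) (n : ℕ) : ℝ := ∑ i ∈ range n, k (i + 1)

theorem partialSum_zero (k : ℕ → ℝ) : partialSum k 0 = 0 := by simp [partialSum]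

theorem partialSum_succ (k : ℕ → ℝ) (n : ℕ) :
    partialSum k (n + 1) = partialSum k n + k (n + 1) := by
  simp [partialSum, sum_range_succ]

theorem weightedIncrements_succ (e X : ℕ → ℝ) (n : ℕ) :
    weightedIncrements e X (n + 1) = weightedIncrements e X n + e (n + 1) * (X (n + 1) - X n) := by
  simp [weightedIncrements, sum_range_succ]

theorem weightedIncrements_sub (e X Y : ℕ → ℝ) (n : ℕ) :
    weightedIncrements e Y n - weightedIncrements e X n =
      weightedIncrements e (fun t => Y t - X t) n := by
  simp only [weightedIncrements, ← sum_sub_distrib]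
  exact sum_congr rfl fun i _ => by ring

/-- Abel summation as an induction: because `D` is nonnegative and the weights do not increase, the
bound for day `n` survives with the smaller weight of day `n + 1`, and the next increment supplies
the rest. -/
theorem mul_le_weightedIncrements {e D : ℕ → ℝ} {n : ℕ} (h0 : D 0 = 0) (hD : ∀ t ≤ n + 1, 0 ≤ D t)
    (he : ∀ t, 1 ≤ t → t < n + 1 → e (t + 1) ≤ e t) :
    e (n + 1) * D (n + 1) ≤ weightedIncrements e D (n + 1) := by
  induction n with
  | zero => simp [weightedIncrements, h0]
  | succ n ih =>
    have h1 := ih (fun t ht => hD t (by omega)) (fun t h1 h2 => he t h1 (by omega))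
    have h2 := mul_le_mul_of_nonneg_right (he (n + 1) (by omega) (by omega)) (hD (n + 1) (by omega))
    rw [weightedIncrements_succ]
    linarith

/-- Summation by parts: for nonincreasing nonnegative weights a larger sequence has larger
weighted increments. -/
theorem weightedIncrements_mono {e X Y : ℕ → ℝ} {n : ℕ} (h0 : X 0 = Y 0)
    (hXY : ∀ t ≤ n, X t ≤ Y t) (he : ∀ t, 1 ≤ t → t < n → e (t + 1) ≤ e t)
    (hn : ∀ t, 1 ≤ t → t ≤ n → 0 ≤ e t) :
    weightedIncrements e X n ≤ weightedIncrements e Y n := by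
  rw [← sub_nonneg, weightedIncrements_sub]
  cases n with
  | zero => simp [weightedIncrements]
  | succ n =>
    refine le_trans ?_ (mul_le_weightedIncrements (by simp [h0])
      (fun t ht => sub_nonneg.2 (hXY t ht)) he)
    exact mul_nonneg (hn _ (by omega) le_rfl) (sub_nonneg.2 (hXY _ le_rfl))

theorem spend_mono {B B' k : ℕ → ℝ} {n : ℕ} (h : ∀ t, 1 ≤ t → t ≤ n → B t ≤ B' t) :
    spend B k n ≤ spend B' k n := by
  induction n with
  | zero => simp [spend]
  | succ n ih =>
    have := ih fun t h1 h2 => h t h1 (by omega)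
    exact min_le_min (h _ (by omega) le_rfl) (by linarith)

/-- The greedy spending dominates every feasible spending. -/
theorem le_spend {B k y : ℕ → ℝ} {n : ℕ} (h0 : y 0 = 0) (hB : ∀ t, 1 ≤ t → t ≤ n → y t ≤ B t)
    (hk : ∀ t < n, y (t + 1) ≤ y t + k (t + 1)) : y n ≤ spend B k n := by
  induction n with
  | zero => simp [spend, h0]
  | succ n ih =>
    have := ih (fun t h1 h2 => hB t h1 (by omega)) (fun t ht => hk t (by omega))
    exact le_min (hB _ (by omega) le_rfl) (by linarith [hk n (by omega)])

/-- The greedy recursion also serves with units in place of money: a constant budget `d` and the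
caps `V` describe buying the cheapest `d` units. -/
theorem spend_const {d : ℝ} {k : ℕ → ℝ} {n : ℕ} (hd : 0 ≤ d)
    (hk : ∀ t, 1 ≤ t → t ≤ n → 0 ≤ k t) :
    spend (fun _ => d) k n = min d (partialSum k n) := by
  induction n with
  | zero => simp [spend, partialSum_zero, hd]
  | succ n ih =>
    have h1 := hk (n + 1) (by omega) le_rfl
    rw [spend, ih fun t h1 h2 => hk t h1 (by omega), partialSum_succ, ← min_add_add_right,
      ← min_assoc, min_eq_left (show d ≤ d + k (n + 1) by linarith)]

theorem gain_mono {e B B' k : ℕ → ℝ} {n : ℕ} (h : ∀ t, 1 ≤ t → t ≤ n → B t ≤ B' t)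
    (he : ∀ t, 1 ≤ t → t < n → e (t + 1) ≤ e t) (hn : ∀ t, 1 ≤ t → t ≤ n → 0 ≤ e t) :
    gain e B k n ≤ gain e B' k n :=
  weightedIncrements_mono rfl
    (fun _ ht => spend_mono fun u h1 h2 => h u h1 (h2.trans ht)) he hn

theorem gain_congr {e e' B B' k k' : ℕ → ℝ} {n : ℕ} (he : ∀ t, 1 ≤ t → t ≤ n → e t = e' t)
    (hB : ∀ t, 1 ≤ t → t ≤ n → B t = B' t) (hk : ∀ t, 1 ≤ t → t ≤ n → k t = k' t) :
    gain e B k n = gain e' B' k' n := by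
  have hs : ∀ m ≤ n, spend B k m = spend B' k' m := by
    intro m hm
    induction m with
    | zero => rfl
    | succ m ih => rw [spend, spend, hB _ (by omega) hm, hk _ (by omega) hm, ih (by omega)]
  unfold gain weightedIncrements
  refine sum_congr rfl fun i hi => ?_
  have hi := mem_range.1 hi
  rw [he _ (by omega) hi, hs _ hi, hs _ hi.le]

/-- The greedy gain is concave in a parameter on which all budgets depend in a concave way. -/
theorem concaveOn_gain {s : Set ℝ} (hs : Convex ℝ s) {e k : ℕ → ℝ} {B : ℝ → ℕ → ℝ} {n : ℕ}
    (hB : ∀ t, 1 ≤ t → t ≤ n → ConcaveOn ℝ s fun x => B x t)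
    (he : ∀ t, 1 ≤ t → t < n → e (t + 1) ≤ e t) (hn : ∀ t, 1 ≤ t → t ≤ n → 0 ≤ e t) :
    ConcaveOn ℝ s fun x => gain e (B x) k n := by
  -- Minima of concave functions are concave.
  have hW : ∀ m ≤ n, ConcaveOn ℝ s fun x => spend (B x) k m := by
    intro m hm
    induction m with
    | zero => exact concaveOn_const 0 hs
    | succ m ih =>
      exact (hB _ (by omega) hm).inf ((ih (by omega)).add (concaveOn_const (k (m + 1)) hs))
  -- With `W` the spending, the identity `gain (m+1) - x W (m+1) = (gain m - e (m+1) W m) + (e (m+1)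
  -- - x) W (m+1)` closes the induction: `e (m+1) ≤ e m` is admissible as the new `x`. The claim is
  -- the case `x = 0`.
  have hQ : ∀ m ≤ n, ∀ x : ℝ, 0 ≤ x → (1 ≤ m → x ≤ e m) →
      ConcaveOn ℝ s fun u => gain e (B u) k m - x * spend (B u) k m := by
    intro m hm
    induction m with
    | zero =>
      intro x _ _
      simpa [gain, weightedIncrements, spend] using concaveOn_const (0 : ℝ) hs
    | succ m ih =>
      intro x hx hxe
      have h1 := ih (by omega) (e (m + 1)) (hn _ (by omega) hm) (fun h => he m h (by omega))
      have h2 := (hW (m + 1) hm).smul (sub_nonneg.2 (hxe (by omega)))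
      refine (h1.add h2).congr fun u _ => ?_
      simp only [gain, weightedIncrements_succ, Pi.add_apply, smul_eq_mul]
      ring
  simpa using hQ n le_rfl 0 le_rfl (fun h => hn n h le_rfl)

/-! ### Affine pieces -/

/-- `f` is affine on the interval `[a, b]`. -/
def AffineOn (a b : ℝ) (f : ℝ → ℝ) : Prop := ∃ m q : ℝ, ∀ x ∈ Set.Icc a b, f x = m * x + q

namespace AffineOn

variable {a b : ℝ} {f g : ℝ → ℝ}

theorem congr (hf : AffineOn a b f) (h : ∀ x ∈ Set.Icc a b, g x = f x) : AffineOn a b g :=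
  let ⟨m, q, hm⟩ := hf
  ⟨m, q, fun x hx => (h x hx).trans (hm x hx)⟩

theorem const (c : ℝ) : AffineOn a b fun _ => c := ⟨0, c, fun _ _ => by ring⟩

theorem id : AffineOn a b fun x => x := ⟨1, 0, fun _ _ => by ring⟩

theorem sub (hf : AffineOn a b f) (hg : AffineOn a b g) : AffineOn a b fun x => f x - g x :=
  let ⟨m, q, hm⟩ := hf
  let ⟨m', q', hm'⟩ := hg
  ⟨m - m', q - q', fun x hx => by linear_combination hm x hx - hm' x hx⟩

theorem add (hf : AffineOn a b f) (hg : AffineOn a b g) : AffineOn a b fun x => f x + g x :=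
  let ⟨m, q, hm⟩ := hf
  let ⟨m', q', hm'⟩ := hg
  ⟨m + m', q + q', fun x hx => by linear_combination hm x hx + hm' x hx⟩

theorem const_mul (c : ℝ) (hf : AffineOn a b f) : AffineOn a b fun x => c * f x :=
  let ⟨m, q, hm⟩ := hf
  ⟨c * m, c * q, fun x hx => by linear_combination c * hm x hx⟩

theorem weightedIncrements (e : ℕ → ℝ) {X : ℝ → ℕ → ℝ} {n : ℕ}
    (h : ∀ t ≤ n, AffineOn a b fun x => X x t) :
    AffineOn a b fun x => weightedIncrements e (X x) n := by
  induction n with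
  | zero => exact (const 0).congr fun x _ => by simp [RobustOrdering.weightedIncrements]
  | succ n ih =>
    refine ((ih fun t ht => h t (by omega)).add
      (((h (n + 1) le_rfl).sub (h n (by omega))).const_mul (e (n + 1)))).congr fun x _ => ?_
    rw [weightedIncrements_succ]

theorem concaveOn (hf : AffineOn a b f) : ConcaveOn ℝ (Set.Icc a b) f := by
  obtain ⟨m, q, hm⟩ := hf
  refine ⟨convex_Icc a b, fun x hx y hy u v hu hv huv => le_of_eq ?_⟩
  rw [hm x hx, hm y hy, hm _ ((convex_Icc a b) hx hy hu hv huv)]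
  simp only [smul_eq_mul]
  linear_combination q * huv

theorem min_const {u s : ℝ} (h : ¬(a < s + u ∧ s + u < b)) :
    AffineOn a b fun x => min (x - u) s := by
  rcases not_and_or.1 h with h | h
  · exact (const s).congr fun x hx => min_eq_right (by linarith [hx.1])
  · exact (id.sub (const u)).congr fun x hx => min_eq_left (by linarith [hx.2])

end AffineOn

/-- The ends are the greatest point of `s` below `x` and the least one above it; a point strictly
between them would contradict one of the two choices. -/
theorem exists_bracket (s : Finset ℝ) {lo hi x : ℝ} (hlo : lo ∈ s) (hhi : hi ∈ s)
    (hx : x ∈ Set.Icc lo hi) :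
    ∃ a ∈ s, ∃ b ∈ s, lo ≤ a ∧ b ≤ hi ∧ x ∈ Set.Icc a b ∧ ∀ y ∈ s, ¬(a < y ∧ y < b) := by
  classical
  have h1 : (s.filter (· ≤ x)).Nonempty := ⟨lo, by simp [hlo, hx.1]⟩
  have h2 : (s.filter (x ≤ ·)).Nonempty := ⟨hi, by simp [hhi, hx.2]⟩
  have ha := mem_filter.1 (max'_mem _ h1)
  have hb := mem_filter.1 (min'_mem _ h2)
  refine ⟨_, ha.1, _, hb.1, le_max' _ _ (by simp [hlo, hx.1]), min'_le _ _ (by simp [hhi, hx.2]),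
    ⟨ha.2, hb.2⟩, fun y hy hy' => ?_⟩
  rcases le_total y x with h | h
  · exact absurd (le_max' (s.filter (· ≤ x)) y (by simp [hy, h])) (not_le.2 hy'.1)
  · exact absurd (min'_le (s.filter (x ≤ ·)) y (by simp [hy, h])) (not_le.2 hy'.2)

/-- A function that is concave between consecutive points of a grid is nonnegative if it is
nonnegative at the points of the grid. -/
theorem nonneg_of_nonneg_on_grid (s : Finset ℝ) {lo hi : ℝ} (hlo : lo ∈ s) (hhi : hi ∈ s)
    {f : ℝ → ℝ}
    (hf : ∀ a b, lo ≤ a → b ≤ hi → (∀ y ∈ s, ¬(a < y ∧ y < b)) → ConcaveOn ℝ (Set.Icc a b) f)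
    (h : ∀ x ∈ s, 0 ≤ f x) {x : ℝ} (hx : x ∈ Set.Icc lo hi) : 0 ≤ f x := by
  obtain ⟨a, ha, b, hb, h1, h2, hxab, hs⟩ := exists_bracket s hlo hhi hx
  have hab := hxab.1.trans hxab.2
  have := (hf a b h1 h2 hs).min_le_of_mem_Icc (Set.left_mem_Icc.2 hab) (Set.right_mem_Icc.2 hab) hxab
  exact (le_min (h a ha) (h b hb)).trans this

/-- Between consecutive crossings of the lines `A s - C s - x * G s` the greedy spending under the
budgets `A t - x * G t` is affine in `x`. -/
theorem affineOn_spend {a b : ℝ} {A G k : ℕ → ℝ} {n : ℕ} (hA : A 0 = 0) (hG : G 0 = 0)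
    (h : ∀ s ≤ n, ∀ t ≤ n,
      ¬(a < ((A s - partialSum k s) - (A t - partialSum k t)) / (G s - G t) ∧
        ((A s - partialSum k s) - (A t - partialSum k t)) / (G s - G t) < b)) :
    AffineOn a b fun x => spend (fun t => A t - x * G t) k n := by
  -- Unrolled, greedy spending is the cumulative cap plus the minimum over `s ≤ n` of budget minus
  -- cumulative cap, where `s = 0` contributes `0`. Without crossings a single `s` attains this
  -- minimum throughout `[a, b]`.
  suffices H : ∃ s ≤ n, ∀ x ∈ Set.Icc a b, spend (fun t => A t - x * G t) k n =
      partialSum k n + (A s - partialSum k s) - x * G s by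
    obtain ⟨s, -, hs⟩ := H
    exact ⟨-G s, partialSum k n + (A s - partialSum k s), fun x hx => (hs x hx).trans (by ring)⟩
  induction n with
  | zero => exact ⟨0, le_rfl, fun x _ => by simp [spend, hA, hG, partialSum_zero]⟩
  | succ n ih =>
    obtain ⟨s, hs, hW⟩ := ih fun s hs t ht => h s (by omega) t (by omega)
    have hc := h s (by omega) (n + 1) le_rfl
    set u := A s - partialSum k s with hu
    set w := A (n + 1) - partialSum k (n + 1) with hw
    -- Two lines that do not cross inside the interval keep their order; the sign of the slope
    -- difference tells which is lower.
    have key : (∀ x ∈ Set.Icc a b, u - x * G s ≤ w - x * G (n + 1)) ∨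
        (∀ x ∈ Set.Icc a b, w - x * G (n + 1) ≤ u - x * G s) := by
      rcases lt_trichotomy (G s - G (n + 1)) 0 with hg | hg | hg
      · rcases not_and_or.1 hc with hc | hc
        · rw [not_lt, div_le_iff_of_neg hg] at hc
          right
          intro x hx
          nlinarith [hx.1]
        · rw [not_lt, le_div_iff_of_neg hg] at hc
          left
          intro x hx
          nlinarith [hx.2]
      -- Parallel lines: the quotient in `hc` is a division by zero and carries no information, but
      -- the intercepts decide.
      · rcases le_total u w with h | h
        · left
          intro x _
          have : G s = G (n + 1) := by linarith
          rw [this]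
          linarith
        · right
          intro x _
          have : G s = G (n + 1) := by linarith
          rw [this]
          linarith
      · rcases not_and_or.1 hc with hc | hc
        · rw [not_lt, div_le_iff₀ hg] at hc
          left
          intro x hx
          nlinarith [hx.1]
        · rw [not_lt, le_div_iff₀ hg] at hc
          right
          intro x hx
          nlinarith [hx.2]
    have hp := partialSum_succ k n
    rcases key with key | key
    · refine ⟨s, by omega, fun x hx => ?_⟩
      have := key x hx
      rw [spend, hW x hx, min_eq_right (by linarith)]
      linarith
    · refine ⟨n + 1, le_rfl, fun x hx => ?_⟩
      have := key x hx
      rw [spend, hW x hx, min_eq_left (by linarith)]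
      linarith

/-- The zero of a function on `[0, 1]` that is concave and affine on a bracket `[a, b]` of it. -/
theorem le_secant_root_iff {f : ℝ → ℝ} (hf : ConcaveOn ℝ (Set.Icc 0 1) f) {a b : ℝ}
    (ha : 0 ≤ a) (hb : b ≤ 1) (hfa : 0 ≤ f a) (hab : a < b) (hfb : f b < 0)
    (haff : AffineOn a b f) (h0 : 0 ≤ f 0) {x : ℝ} (hx : x ∈ Set.Icc (0 : ℝ) 1) :
    x ≤ a + (b - a) * (f a / (f a - f b)) ↔ 0 ≤ f x := by
  obtain ⟨m, q, hm⟩ := haff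
  have ea := hm a ⟨le_rfl, hab.le⟩
  have eb := hm b ⟨hab.le, le_rfl⟩
  set r := a + (b - a) * (f a / (f a - f b)) with hr
  have hd : 0 < f a - f b := by linarith
  -- `r` is the zero of the secant through the ends of the bracket, hence of the affine piece.
  have hmr : m * r + q = 0 := by
    rw [hr]
    field_simp
    rw [ea, eb]
    ring
  have har : a ≤ r := by
    have : 0 ≤ (b - a) * (f a / (f a - f b)) := by
      have := div_nonneg hfa hd.le
      have : 0 ≤ b - a := by linarith
      positivity
    linarith
  have hrb : r < b := by
    have : f a / (f a - f b) < 1 := by rw [div_lt_one hd]; linarith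
    nlinarith
  have hfr : f r = 0 := by rw [hm r ⟨har, hrb.le⟩, hmr]
  have hmneg : m < 0 := by
    by_contra h
    have := not_lt.1 h
    nlinarith
  constructor
  · intro hxr
    -- To the left of `r`, concavity bounds `f x` below by the smaller of `f 0` and `f r = 0`.
    have := hf.min_le_of_mem_Icc (x := 0) (y := r) (z := x) (by simp)
      ⟨by linarith, by linarith⟩ ⟨hx.1, hxr⟩
    rw [hfr, min_eq_right h0] at this
    exact this
  · intro hfx
    by_contra hxr
    rw [not_le] at hxr
    rcases le_total x b with hxb | hxb
    · have := hm x ⟨by linarith, hxb⟩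
      nlinarith
    -- Beyond `b`: nonnegative values at `a` and `x` would force `0 ≤ f b`.
    · have := hf.min_le_of_mem_Icc (x := a) (y := x) (z := b) ⟨ha, by linarith⟩ hx ⟨hab.le, hxb⟩
      have := le_min hfa hfx
      linarith

end RobustOrdering

/-! ### The optimal robust ratio of an instance -/

namespace OrderingInstance

open Finset RobustOrdering

variable (I : OrderingInstance)

theorem τ_mono {u v : ℕ} (huv : u ≤ v) (hv : v ≤ I.K) : I.τ u ≤ I.τ v := by
  induction v, huv using Nat.le_induction with
  | base => exact le_rfl
  | succ v _ ih => exact (ih (by omega)).trans (I.τ_lt v (by omega)).le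

theorem γ_mono' {u v : ℕ} (hu : 1 ≤ u) (huv : u ≤ v) (hv : v ≤ I.K) : I.γ u ≤ I.γ v := by
  induction v, huv using Nat.le_induction with
  | base => exact le_rfl
  | succ v h ih => exact (ih (by omega)).trans (I.γ_mono v (by omega) (by omega))

theorem K_le_T : I.K ≤ I.T := by
  have h : ∀ v ≤ I.K, v + 1 ≤ I.τ v := by
    intro v hv
    induction v with
    | zero => rw [I.τ_zero]
    | succ v ih => exact (ih (by omega)).trans_lt (I.τ_lt v (by omega))
  have := h I.K le_rfl
  rw [I.τ_last] at this
  omega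

theorem one_le_T : 1 ≤ I.T := I.one_le_K.trans I.K_le_T

theorem exists_inPhase {t : ℕ} (h1 : 1 ≤ t) (hT : t ≤ I.T) : ∃ v < I.K, I.InPhase v t := by
  have h : ∀ n ≤ I.K, t < I.τ n → ∃ v < n, I.InPhase v t := by
    intro n hn ht
    induction n with
    | zero => rw [I.τ_zero] at ht; omega
    | succ n ih =>
      rcases lt_or_ge t (I.τ n) with h | h
      · obtain ⟨v, hv, hp⟩ := ih (by omega) h
        exact ⟨v, by omega, hp⟩
      · exact ⟨n, by omega, h, ht⟩
  exact h I.K le_rfl (by rw [I.τ_last]; omega)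

theorem inPhase_le {u v s t : ℕ} (hu : I.InPhase u s) (hv : I.InPhase v t) (hst : s ≤ t)
    (huK : u < I.K) : u ≤ v := by
  by_contra h
  have := I.τ_mono (u := v + 1) (v := u) (by omega) huK.le
  have h1 := hu.1
  have h2 := hv.2
  omega

theorem unitCost_eq {v t : ℕ} (hv : v < I.K) (ht : I.InPhase v t) : I.unitCost t = I.γ (v + 1) := by
  rw [unitCost, sum_eq_single_of_mem v (mem_range.2 hv), if_pos ht]
  intro u hu huv
  refine if_neg fun h => huv ?_
  exact le_antisymm (I.inPhase_le h ht le_rfl (mem_range.1 hu)) (I.inPhase_le ht h le_rfl hv)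

theorem unitCost_pos {t : ℕ} (h1 : 1 ≤ t) (hT : t ≤ I.T) : 0 < I.unitCost t := by
  obtain ⟨v, hv, ht⟩ := I.exists_inPhase h1 hT
  rw [I.unitCost_eq hv ht]
  exact I.γ_pos.trans_le (I.γ_mono' le_rfl (by omega) (by omega))

theorem unitCost_lt {t : ℕ} (h1 : 1 ≤ t) (hT : t ≤ I.T) : I.unitCost t < I.p := by
  obtain ⟨v, hv, ht⟩ := I.exists_inPhase h1 hT
  rw [I.unitCost_eq hv ht]
  exact (I.γ_mono' (by omega) (by omega) le_rfl).trans_lt I.γ_lt_p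

theorem unitCost_mono {t : ℕ} (h1 : 1 ≤ t) (hT : t < I.T) : I.unitCost t ≤ I.unitCost (t + 1) := by
  obtain ⟨u, hu, ht⟩ := I.exists_inPhase h1 hT.le
  obtain ⟨v, hv, ht'⟩ := I.exists_inPhase (t := t + 1) (by omega) hT
  rw [I.unitCost_eq hu ht, I.unitCost_eq hv ht']
  have := I.inPhase_le ht ht' (by omega) hu
  exact I.γ_mono' (by omega) (by omega) hv

theorem p_pos : 0 < I.p :=
  (I.unitCost_pos le_rfl I.one_le_T).trans (I.unitCost_lt le_rfl I.one_le_T)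

/-- The margin of a unit ordered on day `t`. -/
noncomputable def margin (t : ℕ) : ℝ := I.p - I.unitCost t

/-- The margin per unit of money spent on day `t`. -/
noncomputable def yieldRate (t : ℕ) : ℝ := (I.p - I.unitCost t) / I.unitCost t

/-- The largest expenditure on day `t`. -/
noncomputable def maxSpend (t : ℕ) : ℝ := I.unitCost t * I.V t

theorem margin_pos {t : ℕ} (h1 : 1 ≤ t) (hT : t ≤ I.T) : 0 ≤ I.margin t :=
  sub_nonneg.2 (I.unitCost_lt h1 hT).le

theorem margin_anti {t : ℕ} (h1 : 1 ≤ t) (hT : t < I.T) : I.margin (t + 1) ≤ I.margin t :=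
  sub_le_sub_left (I.unitCost_mono h1 hT) _

theorem yieldRate_nonneg {t : ℕ} (h1 : 1 ≤ t) (hT : t ≤ I.T) : 0 ≤ I.yieldRate t :=
  div_nonneg (I.margin_pos h1 hT) (I.unitCost_pos h1 hT).le

theorem yieldRate_anti {t : ℕ} (h1 : 1 ≤ t) (hT : t < I.T) : I.yieldRate (t + 1) ≤ I.yieldRate t :=
  div_le_div₀ (I.margin_pos h1 hT.le) (I.margin_anti h1 hT) (I.unitCost_pos h1 hT.le)
    (I.unitCost_mono h1 hT)

theorem maxSpend_nonneg {t : ℕ} (h1 : 1 ≤ t) (hT : t ≤ I.T) : 0 ≤ I.maxSpend t :=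
  mul_nonneg (I.unitCost_pos h1 hT).le (I.V_nonneg t h1 hT)

/-- The profit of the plan that buys the cheapest `d` units. -/
noncomputable def bestProfit (d : ℝ) : ℝ := gain I.margin (fun _ => d) I.V I.T

theorem bestProfit_eq {d : ℝ} (hd : 0 ≤ d) :
    I.bestProfit d = weightedIncrements I.margin (fun t => min d (partialSum I.V t)) I.T := by
  unfold bestProfit gain weightedIncrements
  refine sum_congr rfl fun i hi => ?_
  have hi := mem_range.1 hi
  rw [spend_const hd fun t h1 h2 => I.V_nonneg t h1 (by omega),
    spend_const hd fun t h1 h2 => I.V_nonneg t h1 (by omega)]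

theorem bestProfit_mono {d d' : ℝ} (h : d ≤ d') : I.bestProfit d ≤ I.bestProfit d' :=
  gain_mono (fun _ _ _ => h) (fun _ => I.margin_anti) (fun _ => I.margin_pos)

theorem bestProfit_nonneg {d : ℝ} (hd : 0 ≤ d) : 0 ≤ I.bestProfit d := by
  have h0 : I.bestProfit 0 = 0 := by
    rw [I.bestProfit_eq le_rfl]
    refine sum_eq_zero fun i hi => ?_
    have h : ∀ t ≤ I.T, min 0 (partialSum I.V t) = 0 := fun t ht =>
      min_eq_left (sum_nonneg fun i hi => I.V_nonneg _ (by omega) (by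
        have := mem_range.1 hi
        omega))
    have hi := mem_range.1 hi
    simp only [h _ hi, h _ hi.le, sub_self, mul_zero]
  exact h0 ▸ I.bestProfit_mono hd

/-- The difference `D` of the two truncated capacity sums is nondecreasing from `0` to at most `d' -
d`, and every margin is at most `p`. This Lipschitz bound makes the budgets monotone in the demand.
-/
theorem bestProfit_sub_le {d d' : ℝ} (hd : 0 ≤ d) (h : d ≤ d') :
    I.bestProfit d' - I.bestProfit d ≤ I.p * (d' - d) := by
  rw [I.bestProfit_eq hd, I.bestProfit_eq (hd.trans h), weightedIncrements_sub]
  have hS : ∀ i < I.T, partialSum I.V i ≤ partialSum I.V (i + 1) := fun i hi => by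
    rw [partialSum_succ]
    linarith [I.V_nonneg (i + 1) (by omega) hi]
  set D : ℕ → ℝ := fun t => min d' (partialSum I.V t) - min d (partialSum I.V t) with hD
  have hDm : ∀ i < I.T, D i ≤ D (i + 1) := by
    intro i hi
    have := hS i hi
    simp only [hD]
    rcases min_cases d (partialSum I.V i) with h1 | h1 <;>
    rcases min_cases d (partialSum I.V (i + 1)) with h2 | h2 <;>
    rcases min_cases d' (partialSum I.V i) with h3 | h3 <;>
    rcases min_cases d' (partialSum I.V (i + 1)) with h4 | h4 <;> linarith
  have h1 : weightedIncrements I.margin D I.T ≤ ∑ i ∈ range I.T, I.p * (D (i + 1) - D i) := by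
    refine sum_le_sum fun i hi => ?_
    have hi := mem_range.1 hi
    refine mul_le_mul_of_nonneg_right ?_ (sub_nonneg.2 (hDm i hi))
    exact sub_le_self _ (I.unitCost_pos (by omega) hi).le
  rw [← mul_sum, sum_range_sub] at h1
  have h2 : D 0 = 0 := by simp [hD, partialSum_zero, hd, hd.trans h]
  have h3 : D I.T ≤ d' - d := by
    simp only [hD]
    rcases min_cases d (partialSum I.V I.T) with h1 | h1 <;>
    rcases min_cases d' (partialSum I.V I.T) with h2 | h2 <;> linarith
  refine h1.trans (mul_le_mul_of_nonneg_left (by linarith) I.p_pos.le)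

theorem sum_Icc_eq (f : ℕ → ℝ) (n : ℕ) : ∑ t ∈ Icc 1 n, f t = partialSum f n := by
  rw [partialSum, ← Ico_add_one_right_eq_Icc, sum_Ico_eq_sum_range]
  simp [add_comm]

theorem profit_eq (a : ℕ → ℝ) (d : ℝ) :
    I.profit a d = I.p * min d (partialSum a I.T) - partialSum (fun t => I.unitCost t * a t) I.T := by
  rw [profit, sum_Icc_eq, sum_Icc_eq]

/-- The maximum is attained by ordering the increments of `min d (partialSum V)`. For any other plan
the useful units `min d (partialSum a)` stay below these, so summation by parts applies, and units
beyond `d` only cost. -/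
theorem hindsight_eq {d : ℝ} (hd : 0 ≤ d) : I.hindsight d = I.bestProfit d := by
  refine IsGreatest.csSup_eq ⟨?_, ?_⟩
  · set X : ℕ → ℝ := fun t => min d (partialSum I.V t) with hX
    refine ⟨fun t => X t - X (t - 1), fun t h1 hT => ?_, ?_⟩
    · obtain ⟨i, rfl⟩ : ∃ i, t = i + 1 := ⟨t - 1, by omega⟩
      have hV := I.V_nonneg _ h1 hT
      simp only [hX, Nat.add_sub_cancel, partialSum_succ]
      rcases min_cases d (partialSum I.V i) with h1 | h1 <;>
      rcases min_cases d (partialSum I.V i + I.V (i + 1)) with h2 | h2 <;>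
      constructor <;> linarith
    · have hX0 : X 0 = 0 := by simp [hX, partialSum_zero, hd]
      have hs : partialSum (fun t => X t - X (t - 1)) I.T = X I.T := by
        simp only [partialSum, Nat.add_sub_cancel]
        rw [sum_range_sub, hX0, sub_zero]
      rw [profit_eq, hs, min_eq_right (min_le_left _ _), I.bestProfit_eq hd]
      change weightedIncrements I.margin X I.T = I.p * X I.T - _
      rw [weightedIncrements, ← sub_zero (X I.T), ← hX0, ← sum_range_sub, mul_sum, partialSum, ← sum_sub_distrib]
      refine sum_congr rfl fun i _ => ?_
      simp only [margin, Nat.add_sub_cancel]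
      ring
  · rintro r ⟨a, ha, rfl⟩
    rw [I.bestProfit_eq hd, profit_eq]
    set Y : ℕ → ℝ := fun t => min d (partialSum a t) with hY
    have hY0 : Y 0 = 0 := by simp [hY, partialSum_zero, hd]
    have h1 : weightedIncrements I.margin Y I.T ≤
        weightedIncrements I.margin (fun t => min d (partialSum I.V t)) I.T := by
      refine weightedIncrements_mono (by simp [hY, partialSum_zero]) (fun t ht => ?_)
        (fun _ => I.margin_anti) (fun _ => I.margin_pos)
      refine min_le_min le_rfl (sum_le_sum fun i hi => ?_)
      have := mem_range.1 hi
      exact (ha (i + 1) (by omega) (by omega)).2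
    refine le_trans ?_ h1
    change I.p * Y I.T - _ ≤ _
    rw [← sub_zero (Y I.T), ← hY0, ← sum_range_sub, mul_sum, partialSum, ← sum_sub_distrib]
    refine sum_le_sum fun i hi => ?_
    have hi := mem_range.1 hi
    have h2 : Y (i + 1) - Y i ≤ a (i + 1) := by
      have := (ha (i + 1) (by omega) hi).1
      simp only [hY, partialSum_succ]
      rcases min_cases d (partialSum a i) with h1 | h1 <;>
      rcases min_cases d (partialSum a i + a (i + 1)) with h2 | h2 <;> linarith
    have := mul_le_mul_of_nonneg_left h2 (I.unitCost_pos (t := i + 1) (by omega) hi).le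
    simp only [margin]
    linarith

/-- The largest expenditure that leaves the fraction `φ` of the best profit at the demand `d`. -/
noncomputable def budget (φ d : ℝ) : ℝ := I.p * d - φ * I.bestProfit d

theorem budget_mono {φ d d' : ℝ} (h1 : φ ≤ 1) (hd : 0 ≤ d) (h : d ≤ d') :
    I.budget φ d ≤ I.budget φ d' := by
  have h2 := I.bestProfit_sub_le hd h
  have h3 := mul_le_of_le_one_left (sub_nonneg.2 (I.bestProfit_mono h)) h1
  unfold budget
  linarith

theorem bestProfit_le {d : ℝ} (hd : 0 ≤ d) : I.bestProfit d ≤ I.p * d := by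
  rw [I.bestProfit_eq hd]
  have h1 : weightedIncrements I.margin (fun t => min d (partialSum I.V t)) I.T ≤
      ∑ i ∈ range I.T, I.p * (min d (partialSum I.V (i + 1)) - min d (partialSum I.V i)) := by
    refine sum_le_sum fun i hi => mul_le_mul_of_nonneg_right ?_ (sub_nonneg.2 ?_)
    · exact sub_le_self _ (I.unitCost_pos (by omega) (mem_range.1 hi)).le
    · refine min_le_min le_rfl ?_
      rw [partialSum_succ]
      linarith [I.V_nonneg (i + 1) (by omega) (mem_range.1 hi)]
  refine h1.trans ?_
  rw [← mul_sum, sum_range_sub (fun i => min d (partialSum I.V i)), partialSum_zero,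
    min_eq_right hd, sub_zero]
  exact mul_le_mul_of_nonneg_left (min_le_left _ _) I.p_pos.le

theorem budget_nonneg {φ d : ℝ} (h1 : φ ≤ 1) (hd : 0 ≤ d) : 0 ≤ I.budget φ d := by
  have h2 := I.bestProfit_le hd
  have h3 := mul_le_of_le_one_left (I.bestProfit_nonneg hd) h1
  unfold budget
  linarith

/-- The least lower ends of the predictions whose upper end is `h`. -/
noncomputable def lowerEnd (h : ℝ) : ℕ → ℝ
  | 0 => I.dlo
  | n + 1 => max (lowerEnd h n) (h - I.Δ (n + 1))

theorem dlo_le_lowerEnd (h : ℝ) (n : ℕ) : I.dlo ≤ I.lowerEnd h n := by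
  induction n with
  | zero => exact le_rfl
  | succ n ih => exact ih.trans (le_max_left _ _)

theorem lowerEnd_nonneg (h : ℝ) (n : ℕ) : 0 ≤ I.lowerEnd h n :=
  I.dlo_nonneg.trans (I.dlo_le_lowerEnd h n)

theorem lowerEnd_le {h : ℝ} (hh : I.dlo ≤ h) {n : ℕ} (hn : n ≤ I.T) : I.lowerEnd h n ≤ h := by
  induction n with
  | zero => exact hh
  | succ n ih =>
    exact max_le (ih (by omega)) (sub_le_self _ (I.Δ_nonneg _ (by omega) hn))

/-- The largest surplus of a policy over the ratio `φ` along the predictions with upper end `h`. -/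
noncomputable def slack (φ h : ℝ) : ℝ :=
  gain I.yieldRate (fun t => I.budget φ (I.lowerEnd h t)) I.maxSpend I.T - φ * I.bestProfit h

/-- The policy that spends as much as the budgets for the ratio `φ` allow. -/
noncomputable def greedyPolicy (φ : ℝ) : Policy I where
  -- The sum is the money already spent. The truncation at `0` matters only for inventories that the
  -- policy itself never reaches on regular predictions when `φ ≤ 1`.
  order t a _ x := max 0 (min (I.V t)
    ((I.budget φ a - ∑ v : Fin I.K, I.γ (v + 1) * x v) / I.unitCost t))
  order_mem t h1 hT _ _ _ _ _ :=
    ⟨le_max_left _ _, max_le (I.V_nonneg t h1 hT) (min_le_left _ _)⟩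

/-! ### Which ratios a policy can guarantee -/

variable {I}

/-- All days of a phase have the same cost, so the inventory vector determines the money spent. This
is why spending up to a budget is a legitimate policy. -/
theorem Policy.cost_inventory (π : Policy I) (lo hi : ℕ → ℝ) (n : ℕ) :
    ∑ v : Fin I.K, I.γ (v + 1) * π.inventory lo hi n v =
      partialSum (fun t => I.unitCost t * π.action lo hi t) n := by
  induction n with
  | zero => simp [Policy.inventory, partialSum_zero]
  | succ n ih =>
    rw [partialSum_succ, ← ih, unitCost, ← Fin.sum_univ_eq_sum_range
      (fun v => if I.InPhase v (n + 1) then I.γ (v + 1) else 0), sum_mul, ← sum_add_distrib]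
    refine sum_congr rfl fun v _ => ?_
    simp only [Policy.inventory, Policy.action, Nat.add_sub_cancel]
    split_ifs <;> ring

theorem Policy.inventory_congr (π : Policy I) {lo hi lo' hi' : ℕ → ℝ} {n : ℕ}
    (h : ∀ t, 1 ≤ t → t ≤ n → lo t = lo' t ∧ hi t = hi' t) :
    π.inventory lo hi n = π.inventory lo' hi' n := by
  induction n with
  | zero => rfl
  | succ n ih =>
    have h1 := ih fun t h1 h2 => h t h1 (by omega)
    have h2 := h (n + 1) (by omega) le_rfl
    funext v
    simp only [Policy.inventory, h1, h2.1, h2.2]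

/-- Non-anticipation: predictions may be altered after day `n` without affecting the orders up to
day `n`. -/
theorem Policy.action_congr (π : Policy I) {lo hi lo' hi' : ℕ → ℝ} {n : ℕ} (hn : 1 ≤ n)
    (h : ∀ t, 1 ≤ t → t ≤ n → lo t = lo' t ∧ hi t = hi' t) :
    π.action lo hi n = π.action lo' hi' n := by
  have h2 := h n hn le_rfl
  rw [Policy.action, Policy.action, h2.1, h2.2,
    π.inventory_congr fun t h1 h2 => h t h1 (by omega)]

theorem IsRegular.lo_mono {lo hi : ℕ → ℝ} {d : ℝ} (hr : I.IsRegular lo hi d) {s t : ℕ}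
    (hst : s ≤ t) (ht : t ≤ I.T) : lo s ≤ lo t := by
  induction t, hst using Nat.le_induction with
  | base => exact le_rfl
  | succ t _ ih => exact (ih (by omega)).trans (hr.nested (t + 1) (by omega) ht).1

theorem IsRegular.hi_anti {lo hi : ℕ → ℝ} {d : ℝ} (hr : I.IsRegular lo hi d) {s t : ℕ}
    (hst : s ≤ t) (ht : t ≤ I.T) : hi t ≤ hi s := by
  induction t, hst using Nat.le_induction with
  | base => exact le_rfl
  | succ t _ ih => exact (hr.nested (t + 1) (by omega) ht).2.trans (ih (by omega))

/-- Upper ends only decrease, so `lo t ≥ hi t - Δ t ≥ hi T - Δ t`, and lower ends only increase. -/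
theorem IsRegular.lowerEnd_le {lo hi : ℕ → ℝ} {d : ℝ} (hr : I.IsRegular lo hi d) {t : ℕ}
    (ht : t ≤ I.T) : I.lowerEnd (hi I.T) t ≤ lo t := by
  induction t with
  | zero => exact hr.lo_zero.ge
  | succ t ih =>
    refine max_le ((ih (by omega)).trans (hr.lo_mono (by omega) ht)) ?_
    have := hr.error (t + 1) (by omega) ht
    have := hr.hi_anti ht le_rfl
    linarith

theorem IsRegular.action_mem {lo hi : ℕ → ℝ} {d : ℝ} (hr : I.IsRegular lo hi d) (π : Policy I)
    {t : ℕ} (h1 : 1 ≤ t) (hT : t ≤ I.T) : 0 ≤ π.action lo hi t ∧ π.action lo hi t ≤ I.V t :=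
  π.order_mem t h1 hT _ _ _ (sub_nonneg.2 (hr.le t h1 hT)) (hr.error t h1 hT)

theorem IsRegular.demand_nonneg {lo hi : ℕ → ℝ} {d : ℝ} (hr : I.IsRegular lo hi d) : 0 ≤ d :=
  I.dlo_nonneg.trans (hr.lo_zero.ge.trans ((hr.lo_mono (Nat.zero_le _) le_rfl).trans hr.demand.1))

/-- A policy guarantees the ratio `φ` when its profit is always the fraction `φ` of the best
profit. -/
theorem Policy.le_robustRatio_iff (π : Policy I) {φ : ℝ} (h1 : φ ≤ 1) :
    (φ : EReal) ≤ π.robustRatio ↔ ∀ lo hi d, I.IsRegular lo hi d →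
      φ * I.bestProfit d ≤ I.profit (π.action lo hi) d := by
  simp only [Policy.robustRatio, le_iInf_iff]
  refine forall_congr' fun lo => forall_congr' fun hi => forall_congr' fun d =>
    forall_congr' fun hr => ?_
  have hd := hr.demand_nonneg
  have hb := I.bestProfit_nonneg hd
  rw [Policy.ratio, I.hindsight_eq hd]
  -- When the best profit vanishes, both sides say that the profit is not negative: `⊥` is below
  -- every real `φ`, and the value `1` is enough because `φ ≤ 1`.
  split_ifs with h2 h3
  · rw [h2, mul_zero]
    simp [h3]
  · rw [h2, mul_zero]
    refine iff_of_true ?_ (not_lt.1 h3)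
    exact_mod_cast h1
  · rw [EReal.coe_le_coe_iff, le_div_iff₀ (lt_of_le_of_ne hb (Ne.symm h2))]

theorem profit_le_bestProfit {lo hi : ℕ → ℝ} {d : ℝ} (hr : I.IsRegular lo hi d) (π : Policy I) :
    I.profit (π.action lo hi) d ≤ I.bestProfit d := by
  rw [← I.hindsight_eq hr.demand_nonneg]
  refine le_csSup ⟨I.p * d, ?_⟩ ⟨_, fun t h1 hT => hr.action_mem π h1 hT, rfl⟩
  rintro r ⟨a, ha, rfl⟩
  have h1 : 0 ≤ ∑ t ∈ Icc 1 I.T, I.unitCost t * a t := sum_nonneg fun t ht =>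
    have ht := mem_Icc.1 ht
    mul_nonneg (I.unitCost_pos ht.1 ht.2).le (ha t ht.1 ht.2).1
  have h2 := mul_le_mul_of_nonneg_left
    (min_le_left d (∑ t ∈ Icc 1 I.T, a t)) I.p_pos.le
  unfold profit
  linarith

theorem isRegular_const {d : ℝ} (hd : I.dlo ≤ d) (hd' : d ≤ I.dhi) :
    I.IsRegular (fun t => if t = 0 then I.dlo else d) (fun t => if t = 0 then I.dhi else d) d := by
  have hT := I.one_le_T
  refine ⟨by simp, by simp, fun t h1 h2 => ?_, fun t h1 h2 => ?_, fun t h1 h2 => ?_, ?_⟩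
  · simp [show t ≠ 0 by omega]
  · simp only [show t ≠ 0 by omega, if_false]
    split_ifs <;> simp [hd, hd']
  · simpa [show t ≠ 0 by omega] using I.Δ_nonneg t h1 h2
  · simp [show I.T ≠ 0 by omega]

/-- One regular sequence suffices: the demand `dlo`, predicted exactly from day `1` on. -/
theorem Policy.robustRatio_le_one (π : Policy I) : π.robustRatio ≤ 1 := by
  have hr := isRegular_const (I := I) le_rfl I.dlo_le_dhi
  have hle : π.robustRatio ≤ π.ratio _ _ _ :=
    iInf_le_of_le _ (iInf_le_of_le _ (iInf_le_of_le _ (iInf_le _ hr)))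
  refine hle.trans ?_
  have hp := profit_le_bestProfit hr π
  have hb := I.bestProfit_nonneg I.dlo_nonneg
  rw [Policy.ratio, I.hindsight_eq I.dlo_nonneg]
  split_ifs with h
  · exact bot_le
  · exact le_rfl
  · exact_mod_cast div_le_one_of_le₀ hp hb

theorem partialSum_le {f : ℕ → ℝ} {m n : ℕ} (hmn : m ≤ n) (hf : ∀ t, 1 ≤ t → t ≤ n → 0 ≤ f t) :
    partialSum f m ≤ partialSum f n :=
  sum_le_sum_of_subset_of_nonneg (range_mono hmn) fun i hi _ =>
    hf _ (by omega) (mem_range.1 hi)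

theorem partialSum_congr {f g : ℕ → ℝ} {n : ℕ} (h : ∀ t, 1 ≤ t → t ≤ n → f t = g t) :
    partialSum f n = partialSum g n :=
  sum_congr rfl fun i hi => h _ (by omega) (mem_range.1 hi)

/-- A guaranteed ratio limits the expenditure up to each day. -/
theorem Policy.cost_le_budget {π : Policy I} {φ : ℝ}
    (hπ : ∀ lo hi d, I.IsRegular lo hi d → φ * I.bestProfit d ≤ I.profit (π.action lo hi) d)
    {lo hi : ℕ → ℝ} {d : ℝ} (hr : I.IsRegular lo hi d) {t : ℕ} (h1 : 1 ≤ t) (hT : t ≤ I.T) :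
    partialSum (fun s => I.unitCost s * π.action lo hi s) t ≤ I.budget φ (lo t) := by
  -- After day `t` the prediction collapses to the point `lo t`, which becomes the demand.
  set lo' : ℕ → ℝ := fun s => lo (min s t) with hlo
  set hi' : ℕ → ℝ := fun s => if s ≤ t then hi s else lo t with hhi
  have hr' : I.IsRegular lo' hi' (lo t) := by
    refine ⟨by simp [hlo, hr.lo_zero], by simp [hhi, hr.hi_zero], fun s h3 h4 => ?_,
      fun s h3 h4 => ?_, fun s h3 h4 => ?_, ?_⟩
    · simp only [hlo, hhi]
      split_ifs with h
      · rw [min_eq_left h]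
        exact hr.le s h3 h4
      · rw [min_eq_right (by omega)]
    · simp only [hlo, hhi]
      refine ⟨hr.lo_mono (by omega) (by omega), ?_⟩
      split_ifs with h5 h6 h6
      · exact (hr.nested s h3 h4).2
      · omega
      · exact (hr.le t h1 hT).trans (hr.hi_anti h6 hT)
      · exact le_rfl
    · simp only [hlo, hhi]
      split_ifs with h
      · rw [min_eq_left h]
        exact hr.error s h3 h4
      · rw [min_eq_right (by omega), sub_self]
        exact I.Δ_nonneg s h3 h4
    · simp only [hlo, hhi, min_eq_right hT, le_refl, true_and]
      split_ifs with h
      · rw [le_antisymm h hT]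
        exact hr.le t h1 hT
      · exact le_rfl
  have h2 := hπ _ _ _ hr'
  rw [profit_eq] at h2
  have h3 : partialSum (fun s => I.unitCost s * π.action lo hi s) t =
      partialSum (fun s => I.unitCost s * π.action lo' hi' s) t :=
    partialSum_congr fun s h3 h4 => by
      rw [π.action_congr (lo' := lo') (hi' := hi') h3 fun u _ h6 => by
        simp [hlo, hhi, show u ≤ t by omega]]
  -- Expenditure after day `t` can only lower the profit, and revenue is at most `p * lo t`.
  have h4 := partialSum_le (f := fun s => I.unitCost s * π.action lo' hi' s) hT fun s h3 h4 =>
    mul_nonneg (I.unitCost_pos h3 h4).le (hr'.action_mem π h3 h4).1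
  have h5 := mul_le_mul_of_nonneg_left
    (min_le_left (lo t) (partialSum (π.action lo' hi') I.T)) I.p_pos.le
  unfold budget
  linarith

/-- The money `c a` spent at the rate `(p - c) / c` yields the margin `(p - c) a`. The total is the
profit when every unit is sold. -/
theorem weightedIncrements_yieldRate (a : ℕ → ℝ) :
    weightedIncrements I.yieldRate (partialSum fun t => I.unitCost t * a t) I.T =
      I.p * partialSum a I.T - partialSum (fun t => I.unitCost t * a t) I.T := by
  rw [partialSum, partialSum, mul_sum, ← sum_sub_distrib]
  refine sum_congr rfl fun i hi => ?_
  have := (I.unitCost_pos (t := i + 1) (by omega) (mem_range.1 hi)).ne'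
  rw [partialSum_succ, yieldRate]
  field_simp
  ring

/-- The adversary's sequence: the upper end drops to `h` at once and the lower ends stay as low as
the error bounds permit. -/
theorem isRegular_lowerEnd {h : ℝ} (hlo : I.dlo ≤ h) (hhi : h ≤ I.dhi) :
    I.IsRegular (I.lowerEnd h) (fun t => if t = 0 then I.dhi else h) h := by
  refine ⟨rfl, by simp, fun t h1 hT => ?_, fun t h1 hT => ?_, fun t h1 hT => ?_, ?_⟩
  · simpa [show t ≠ 0 by omega] using I.lowerEnd_le hlo hT
  · obtain ⟨i, rfl⟩ : ∃ i, t = i + 1 := ⟨t - 1, by omega⟩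
    refine ⟨le_max_left _ _, ?_⟩
    simp only [Nat.add_sub_cancel, Nat.succ_ne_zero, if_false]
    split_ifs <;> simp [hhi]
  · obtain ⟨i, rfl⟩ : ∃ i, t = i + 1 := ⟨t - 1, by omega⟩
    have := le_max_right (I.lowerEnd h i) (h - I.Δ (i + 1))
    simp only [Nat.succ_ne_zero, if_false, lowerEnd]
    linarith
  · have := I.one_le_T
    refine ⟨I.lowerEnd_le hlo le_rfl, ?_⟩
    simp [show I.T ≠ 0 by omega]

/-- A guaranteed ratio leaves no negative slack. -/
theorem Policy.slack_nonneg {π : Policy I} {φ : ℝ}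
    (hπ : ∀ lo hi d, I.IsRegular lo hi d → φ * I.bestProfit d ≤ I.profit (π.action lo hi) d)
    {h : ℝ} (hlo : I.dlo ≤ h) (hhi : h ≤ I.dhi) : 0 ≤ I.slack φ h := by
  have hr := isRegular_lowerEnd hlo hhi
  set hi : ℕ → ℝ := fun t => if t = 0 then I.dhi else h
  set a := π.action (I.lowerEnd h) hi with ha
  have h1 := hπ _ _ _ hr
  rw [profit_eq] at h1
  -- The policy's cumulative expenditure obeys the budgets and caps, hence is dominated day by day
  -- by greedy spending.
  have h2 : weightedIncrements I.yieldRate (partialSum fun t => I.unitCost t * a t) I.T ≤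
      gain I.yieldRate (fun t => I.budget φ (I.lowerEnd h t)) I.maxSpend I.T := by
    refine weightedIncrements_mono (partialSum_zero _) (fun t ht => ?_)
      (fun _ => I.yieldRate_anti) (fun _ => I.yieldRate_nonneg)
    refine le_spend (partialSum_zero _) (fun s h1 h2 => Policy.cost_le_budget hπ hr h1 (by omega))
      (fun s hs => ?_)
    rw [partialSum_succ]
    have h4 := mul_le_mul_of_nonneg_left (hr.action_mem π (t := s + 1) (by omega) (by omega)).2
      (I.unitCost_pos (t := s + 1) (by omega) (by omega)).le
    exact add_le_add le_rfl h4
  rw [weightedIncrements_yieldRate] at h2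
  have h3 := mul_le_mul_of_nonneg_left (min_le_right h (partialSum a I.T)) I.p_pos.le
  unfold slack
  linarith

/-- Budgets grow along the prediction, so the money spent never exceeds the next budget and the
truncation at `0` is idle. The second conjunct carries this through the induction. -/
theorem cost_greedyPolicy {φ : ℝ} (h1 : φ ≤ 1) {lo hi : ℕ → ℝ} {d : ℝ}
    (hr : I.IsRegular lo hi d) {n : ℕ} (hn : n ≤ I.T) :
    partialSum (fun t => I.unitCost t * (I.greedyPolicy φ).action lo hi t) n =
        spend (fun t => I.budget φ (lo t)) I.maxSpend n ∧
      spend (fun t => I.budget φ (lo t)) I.maxSpend n ≤ I.budget φ (lo n) := by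
  have hlo : ∀ t ≤ I.T, 0 ≤ lo t := fun t ht =>
    I.dlo_nonneg.trans (hr.lo_zero.ge.trans (hr.lo_mono (Nat.zero_le _) ht))
  induction n with
  | zero => exact ⟨by simp [partialSum_zero, spend], I.budget_nonneg h1 (hlo 0 hn)⟩
  | succ n ih =>
    obtain ⟨h2, h3⟩ := ih (by omega)
    refine ⟨?_, min_le_left _ _⟩
    have hc := I.unitCost_pos (t := n + 1) (by omega) hn
    have hV := I.V_nonneg (n + 1) (by omega) hn
    have hB := I.budget_mono h1 (hlo n (by omega)) (hr.lo_mono (Nat.le_succ n) hn)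
    rw [partialSum_succ, Policy.action, Nat.add_sub_cancel]
    simp only [greedyPolicy]
    have hinv := Policy.cost_inventory (I.greedyPolicy φ) lo hi n
    simp only [greedyPolicy] at hinv h2
    rw [hinv, h2, spend]
    set W := spend (fun t => I.budget φ (lo t)) I.maxSpend n
    set b := I.budget φ (lo (n + 1))
    have hq : 0 ≤ (b - W) / I.unitCost (n + 1) := div_nonneg (by linarith) hc.le
    rw [max_eq_right (le_min hV hq), mul_min_of_nonneg _ _ hc.le, mul_div_cancel₀ _ hc.ne',
      ← min_add_add_left, min_comm, add_sub_cancel]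
    rfl

/-- The greedy policy guarantees the ratio `φ` when no slack is negative. -/
theorem le_profit_greedyPolicy {φ : ℝ} (h0 : 0 ≤ φ) (h1 : φ ≤ 1)
    (hs : ∀ h ∈ Set.Icc I.dlo I.dhi, 0 ≤ I.slack φ h) {lo hi : ℕ → ℝ} {d : ℝ}
    (hr : I.IsRegular lo hi d) :
    φ * I.bestProfit d ≤ I.profit ((I.greedyPolicy φ).action lo hi) d := by
  set a := (I.greedyPolicy φ).action lo hi with ha
  have hd := hr.demand_nonneg
  have hlo : ∀ t ≤ I.T, 0 ≤ lo t := fun t ht =>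
    I.dlo_nonneg.trans (hr.lo_zero.ge.trans (hr.lo_mono (Nat.zero_le _) ht))
  have hcost : ∀ n ≤ I.T, partialSum (fun t => I.unitCost t * a t) n =
      spend (fun t => I.budget φ (lo t)) I.maxSpend n := fun n hn =>
    (cost_greedyPolicy h1 hr hn).1
  -- This settles the case in which the orders cover the demand: the revenue is `p * d`, and the
  -- expenditure is within the budget.
  have hA : partialSum (fun t => I.unitCost t * a t) I.T ≤ I.budget φ d :=
    (hcost I.T le_rfl).trans_le ((cost_greedyPolicy h1 hr le_rfl).2.trans
      (I.budget_mono h1 (hlo _ le_rfl) hr.demand.1))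
  -- This settles the case in which every unit is sold: compare with the worst sequence ending at
  -- `hi T`, then use that the best profit increases from `d` to `hi T`.
  have hB : φ * I.bestProfit d ≤ I.p * partialSum a I.T -
      partialSum (fun t => I.unitCost t * a t) I.T := by
    have h2 := hs (hi I.T) ⟨hr.lo_zero.ge.trans ((hr.lo_mono (Nat.zero_le _) le_rfl).trans
      (hr.demand.1.trans hr.demand.2)), (hr.hi_anti (Nat.zero_le _) le_rfl).trans hr.hi_zero.le⟩
    have h3 : gain I.yieldRate (fun t => I.budget φ (I.lowerEnd (hi I.T) t)) I.maxSpend I.T ≤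
        gain I.yieldRate (fun t => I.budget φ (lo t)) I.maxSpend I.T :=
      gain_mono (fun t _ hT => I.budget_mono h1 (I.lowerEnd_nonneg _ _) (hr.lowerEnd_le hT))
        (fun _ => I.yieldRate_anti) (fun _ => I.yieldRate_nonneg)
    have h4 : gain I.yieldRate (fun t => I.budget φ (lo t)) I.maxSpend I.T =
        I.p * partialSum a I.T - partialSum (fun t => I.unitCost t * a t) I.T := by
      rw [← weightedIncrements_yieldRate, gain, weightedIncrements, weightedIncrements]
      refine sum_congr rfl fun i hi => ?_
      have hi := mem_range.1 hi
      rw [hcost _ hi, hcost _ hi.le]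
    have h5 := mul_le_mul_of_nonneg_left (I.bestProfit_mono hr.demand.2) h0
    unfold slack at h2
    linarith
  rw [profit_eq]
  unfold budget at hA
  rcases min_cases d (partialSum a I.T) with h | h <;> rw [h.1] <;> linarith

/-- The optimal robust ratio is the largest `φ ∈ [0, 1]` without negative slack. -/
theorem optimalRatio_eq {r : ℝ} (h0 : 0 ≤ r) (h1 : r ≤ 1)
    (hr : ∀ φ ∈ Set.Icc (0 : ℝ) 1, φ ≤ r ↔ ∀ h ∈ Set.Icc I.dlo I.dhi, 0 ≤ I.slack φ h) :
    I.optimalRatio = (r : EReal) := by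
  refine le_antisymm (iSup_le fun π => ?_) ?_
  · by_contra hlt
    -- A policy better than `r` would guarantee a real ratio `φ` with `r < φ ≤ 1`, hence leave no
    -- negative slack at `φ`.
    obtain ⟨φ, hφ, hφ'⟩ := EReal.lt_iff_exists_real_btwn.1 (not_le.1 hlt)
    have h2 : r < φ := EReal.coe_lt_coe_iff.1 hφ
    have h3 : φ ≤ 1 := by exact_mod_cast hφ'.le.trans π.robustRatio_le_one
    have h4 := (π.le_robustRatio_iff h3).1 hφ'.le
    exact not_le.2 h2 ((hr φ ⟨h0.trans h2.le, h3⟩).2 fun h hh =>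
      Policy.slack_nonneg h4 hh.1 hh.2)
  · refine le_iSup_of_le (I.greedyPolicy r) (((I.greedyPolicy r).le_robustRatio_iff h1).2 ?_)
    exact fun lo hi d hreg =>
      le_profit_greedyPolicy h0 h1 ((hr r ⟨h0, h1⟩).1 le_rfl) hreg

end OrderingInstance

/-! ### Finitely many tests for the slack -/

namespace OrderingInstance

open Finset RobustOrdering

variable (I : OrderingInstance)

/-- `x` moved into the interval `[lo, hi]`. -/
noncomputable def clamp (lo hi x : ℝ) : ℝ := max lo (min hi x)

theorem clamp_mem {lo hi : ℝ} (h : lo ≤ hi) (x : ℝ) : clamp lo hi x ∈ Set.Icc lo hi :=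
  ⟨le_max_left _ _, max_le h (min_le_left _ _)⟩

theorem clamp_of_mem {lo hi x : ℝ} (h : x ∈ Set.Icc lo hi) : clamp lo hi x = x := by
  rw [clamp, min_eq_right h.2, max_eq_right h.1]

/-- The error bounds, with the bound `0` on day `0`. -/
noncomputable def errorBound (t : ℕ) : ℝ := if t = 0 then 0 else I.Δ t

/-- The cumulative capacities, followed by the ends of the initial interval. -/
noncomputable def gridBase (j : ℕ) : ℝ :=
  if j ≤ I.T then partialSum I.V j else if j = I.T + 1 then I.dlo else I.dhi

/-- The demands at which the ratio is tested. -/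
noncomputable def gridPoint (j t : ℕ) : ℝ := clamp I.dlo I.dhi (I.gridBase j + I.errorBound t)

theorem gridPoint_mem (j t : ℕ) : I.gridPoint j t ∈ Set.Icc I.dlo I.dhi :=
  clamp_mem I.dlo_le_dhi _

/-- The kinks of the best profit are the cumulative capacities, here shifted by `u`. The condition
on `a - u` keeps the demand nonnegative. -/
theorem affineOn_bestProfit_sub {a b u : ℝ} (hu : 0 ≤ a - u)
    (hS : ∀ j ≤ I.T, ¬(a < partialSum I.V j + u ∧ partialSum I.V j + u < b)) :
    AffineOn a b fun x => I.bestProfit (x - u) := by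
  refine (AffineOn.weightedIncrements I.margin (n := I.T)
    fun t ht => AffineOn.min_const (hS t ht)).congr fun x hx => ?_
  rw [I.bestProfit_eq (by linarith [hx.1])]

/-- The lower end is the maximum of `dlo` and the lines `x - Δ t`. These lines are parallel, so the
maximum changes branch only where one of them meets `dlo`. -/
theorem lowerEnd_eq_or {a b : ℝ} {n : ℕ}
    (h : ∀ t, 1 ≤ t → t ≤ n → ¬(a < I.dlo + I.Δ t ∧ I.dlo + I.Δ t < b)) :
    (∀ x ∈ Set.Icc a b, I.lowerEnd x n = I.dlo) ∨
      ∃ t, 1 ≤ t ∧ t ≤ n ∧ ∀ x ∈ Set.Icc a b, I.lowerEnd x n = x - I.Δ t := by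
  induction n with
  | zero => exact Or.inl fun x _ => rfl
  | succ n ih =>
    rcases ih fun t h1 h2 => h t h1 (by omega) with hc | ⟨t, h1, h2, ht⟩
    · rcases not_and_or.1 (h (n + 1) (by omega) le_rfl) with hn | hn
      · refine Or.inr ⟨n + 1, by omega, le_rfl, fun x hx => ?_⟩
        rw [lowerEnd, hc x hx, max_eq_right (by linarith [hx.1])]
      · refine Or.inl fun x hx => ?_
        rw [lowerEnd, hc x hx, max_eq_left (by linarith [hx.2])]
    · rcases le_total (I.Δ t) (I.Δ (n + 1)) with hd | hd
      · refine Or.inr ⟨t, h1, by omega, fun x hx => ?_⟩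
        rw [lowerEnd, ht x hx, max_eq_left (by linarith)]
      · refine Or.inr ⟨n + 1, by omega, le_rfl, fun x hx => ?_⟩
        rw [lowerEnd, ht x hx, max_eq_right (by linarith)]

/-- Between grid values every budget is affine in the demand, so the greedy margin is concave; the
subtracted multiple of the best profit is affine there. -/
theorem concaveOn_slack_demand {φ a b : ℝ} (ha : I.dlo ≤ a)
    (h : ∀ j ≤ I.T + 2, ∀ t ≤ I.T, ¬(a < I.gridBase j + I.errorBound t ∧
      I.gridBase j + I.errorBound t < b)) :
    ConcaveOn ℝ (Set.Icc a b) fun x => I.slack φ x := by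
  rcases lt_or_ge b a with hba | hab
  · rw [Set.Icc_eq_empty (not_le.2 hba)]
    exact ⟨convex_empty, fun x hx => hx.elim⟩
  have hS : ∀ t ≤ I.T, ∀ j ≤ I.T,
      ¬(a < partialSum I.V j + I.errorBound t ∧ partialSum I.V j + I.errorBound t < b) := by
    intro t ht j hj
    have := h j (by omega) t ht
    rwa [gridBase, if_pos hj] at this
  have hR : AffineOn a b fun x => I.bestProfit x := by
    -- The unshifted kinks are grid values thanks to the error bound `0` of day `0`.
    have := I.affineOn_bestProfit_sub (a := a) (b := b) (u := 0)
      (by linarith [I.dlo_nonneg]) (by simpa [errorBound] using hS 0 (Nat.zero_le _))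
    simpa using this
  have hB : ∀ t ≤ I.T, AffineOn a b fun x => I.budget φ (I.lowerEnd x t) := by
    intro t ht
    have hD : ∀ s, 1 ≤ s → s ≤ t → ¬(a < I.dlo + I.Δ s ∧ I.dlo + I.Δ s < b) := by
      intro s h1 h2
      have := h (I.T + 1) (by omega) s (by omega)
      simpa [gridBase, errorBound, show s ≠ 0 by omega] using this
    rcases I.lowerEnd_eq_or hD with hc | ⟨s, h1, h2, hs⟩
    · exact (AffineOn.const (I.budget φ I.dlo)).congr fun x hx => by rw [hc x hx]
    · have ha' : 0 ≤ a - I.Δ s := by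
        rw [← hs a ⟨le_rfl, hab⟩]
        exact I.lowerEnd_nonneg _ _
      have h3 := I.affineOn_bestProfit_sub (b := b) ha' (by
        simpa [errorBound, show s ≠ 0 by omega] using hS s (by omega))
      exact (((AffineOn.id.sub (AffineOn.const (I.Δ s))).const_mul I.p).sub
        (h3.const_mul φ)).congr fun x hx => by rw [hs x hx, budget]
  have h4 := concaveOn_gain (convex_Icc a b) (e := I.yieldRate) (k := I.maxSpend)
    (B := fun x t => I.budget φ (I.lowerEnd x t)) (fun t _ ht => (hB t ht).concaveOn)
    (fun _ => I.yieldRate_anti) (fun _ => I.yieldRate_nonneg)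
  have h5 := (hR.const_mul (-φ)).concaveOn
  refine (h4.add h5).congr fun x _ => ?_
  simp only [slack, Pi.add_apply]
  ring

/-- It suffices to test the slack at the grid points. -/
theorem slack_nonneg_of_grid {φ : ℝ}
    (h : ∀ j < I.T + 3, ∀ t < I.T + 1, 0 ≤ I.slack φ (I.gridPoint j t)) :
    ∀ x ∈ Set.Icc I.dlo I.dhi, 0 ≤ I.slack φ x := by
  intro x hx
  set s : Finset ℝ :=
    (range (I.T + 3) ×ˢ range (I.T + 1)).image fun q => I.gridPoint q.1 q.2 with hs
  have hmem : ∀ j < I.T + 3, ∀ t < I.T + 1, I.gridPoint j t ∈ s := fun j hj t ht =>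
    mem_image.2 ⟨(j, t), by simp [hj, ht], rfl⟩
  have hlo : I.dlo ∈ s := by
    have := hmem (I.T + 1) (by omega) 0 (by omega)
    rwa [gridPoint, gridBase, errorBound, if_neg (by omega), if_pos rfl, if_pos rfl, add_zero,
      clamp_of_mem ⟨le_rfl, I.dlo_le_dhi⟩] at this
  have hhi : I.dhi ∈ s := by
    have := hmem (I.T + 2) (by omega) 0 (by omega)
    rwa [gridPoint, gridBase, errorBound, if_neg (by omega), if_neg (by omega), if_pos rfl,
      add_zero, clamp_of_mem ⟨I.dlo_le_dhi, le_rfl⟩] at this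
  refine nonneg_of_nonneg_on_grid s hlo hhi (f := fun x => I.slack φ x) (fun a b ha hb hab => ?_)
    (fun y hy => ?_) hx
  · refine I.concaveOn_slack_demand ha fun j hj t ht hc => ?_
    refine hab _ (hmem j (by omega) t (by omega)) ?_
    -- A breakpoint strictly inside `[a, b]` lies in `[dlo, dhi]`, so clamping leaves it fixed and
    -- it belongs to the grid.
    rwa [gridPoint, clamp_of_mem ⟨by linarith, by linarith⟩]
  · obtain ⟨q, hq, rfl⟩ := mem_image.1 hy
    have := mem_product.1 hq
    exact h _ (mem_range.1 this.1) _ (mem_range.1 this.2)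

/-- The budget on day `t` is the line `φ ↦ lineBase t - φ * lineSlope t`. -/
noncomputable def lineBase (h : ℝ) (t : ℕ) : ℝ := if t = 0 then 0 else I.p * I.lowerEnd h t

/-- The budget on day `t` is the line `φ ↦ lineBase t - φ * lineSlope t`. -/
noncomputable def lineSlope (h : ℝ) (t : ℕ) : ℝ :=
  if t = 0 then 0 else I.bestProfit (I.lowerEnd h t)

/-- The ratio at which the lines of the days `s` and `t` cross. -/
noncomputable def crossing (h : ℝ) (s t : ℕ) : ℝ :=
  clamp 0 1 (((I.lineBase h s - partialSum I.maxSpend s) -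
    (I.lineBase h t - partialSum I.maxSpend t)) / (I.lineSlope h s - I.lineSlope h t))

theorem crossing_mem (h : ℝ) (s t : ℕ) : I.crossing h s t ∈ Set.Icc (0 : ℝ) 1 :=
  clamp_mem zero_le_one _

/-- The gain reads budgets from day `1` on only. Index `0` is thus free for the zero line, which
stands for unrestricted spending from the start. -/
theorem slack_eq (φ h : ℝ) : I.slack φ h =
    gain I.yieldRate (fun t => I.lineBase h t - φ * I.lineSlope h t) I.maxSpend I.T -
      φ * I.bestProfit h := by
  rw [slack]
  congr 1
  refine gain_congr (fun _ _ _ => rfl) (fun t h1 _ => ?_) (fun _ _ _ => rfl)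
  rw [lineBase, lineSlope, if_neg (by omega), if_neg (by omega), budget]

theorem affineOn_slack_ratio {a b h : ℝ} (ha : 0 ≤ a) (hb : b ≤ 1)
    (hc : ∀ s < I.T + 1, ∀ t < I.T + 1, ¬(a < I.crossing h s t ∧ I.crossing h s t < b)) :
    AffineOn a b fun φ => I.slack φ h := by
  have h1 : ∀ n ≤ I.T, AffineOn a b fun φ =>
      spend (fun t => I.lineBase h t - φ * I.lineSlope h t) I.maxSpend n := by
    intro n hn
    refine affineOn_spend (by simp [lineBase]) (by simp [lineSlope]) fun s hs t ht hst => ?_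
    refine hc s (by omega) t (by omega) ?_
    rwa [crossing, clamp_of_mem ⟨by linarith, by linarith⟩]
  refine ((AffineOn.weightedIncrements I.yieldRate h1).sub
    (AffineOn.id.const_mul (I.bestProfit h))).congr fun φ _ => ?_
  rw [slack_eq, gain, mul_comm φ]

theorem concaveOn_slack_ratio (h : ℝ) : ConcaveOn ℝ (Set.Icc 0 1) fun φ => I.slack φ h := by
  have h4 := concaveOn_gain (convex_Icc (0 : ℝ) 1) (e := I.yieldRate) (k := I.maxSpend)
    (B := fun φ t => I.lineBase h t - φ * I.lineSlope h t) (n := I.T)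
    (fun t _ _ => ((AffineOn.const (I.lineBase h t)).sub
      (AffineOn.id.const_mul (I.lineSlope h t))).concaveOn.congr
        fun x _ => by simp only [mul_comm])
    (fun _ => I.yieldRate_anti) (fun _ => I.yieldRate_nonneg)
  have h5 := (AffineOn.id.const_mul (a := 0) (b := 1) (-I.bestProfit h)).concaveOn
  refine (h4.add h5).congr fun x _ => ?_
  simp only [slack_eq, Pi.add_apply]
  ring

/-- Spending nothing is feasible. Hence `0` is always a valid left end of a bracket, and by
concavity the ratios with nonnegative slack form an initial segment of `[0, 1]`. -/
theorem slack_zero_nonneg (h : ℝ) : 0 ≤ I.slack 0 h := by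
  have h1 : weightedIncrements I.yieldRate (fun _ => 0) I.T ≤
      gain I.yieldRate (fun t => I.budget 0 (I.lowerEnd h t)) I.maxSpend I.T := by
    refine weightedIncrements_mono rfl (fun t ht => ?_)
      (fun _ => I.yieldRate_anti) (fun _ => I.yieldRate_nonneg)
    exact le_spend (y := fun _ => 0) rfl
      (fun s _ _ => I.budget_nonneg zero_le_one (I.lowerEnd_nonneg h s))
      fun s hs => by simpa using I.maxSpend_nonneg (t := s + 1) (by omega) (by omega)
  rw [slack, zero_mul, sub_zero]
  simpa [weightedIncrements] using h1

/-- The ratio with slack zero from a bracket without crossings. -/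
theorem le_root_iff {h a b : ℝ} (ha : a ∈ Set.Icc (0 : ℝ) 1) (hb : b ∈ Set.Icc (0 : ℝ) 1)
    (hfa : 0 ≤ I.slack a h) (h1 : 0 ≤ I.slack 1 h → a = 1 ∧ b = 1)
    (hfb : I.slack 1 h < 0 → I.slack b h < 0)
    (hc : ∀ s < I.T + 1, ∀ t < I.T + 1,
      (0 ≤ I.slack (I.crossing h s t) h → I.crossing h s t ≤ a) ∧
      (I.slack (I.crossing h s t) h < 0 → b ≤ I.crossing h s t))
    {φ : ℝ} (hφ : φ ∈ Set.Icc (0 : ℝ) 1) :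
    φ ≤ a + (b - a) * (I.slack a h / (I.slack a h - I.slack b h)) ↔ 0 ≤ I.slack φ h := by
  have hconc := I.concaveOn_slack_ratio h
  rcases le_or_gt 0 (I.slack 1 h) with h1' | h1'
  · obtain ⟨rfl, rfl⟩ := h1 h1'
    -- No sign change on `[0, 1]`: the bracket is degenerate and the formula returns `1`, the factor
    -- `b - a` removing the quotient by zero.
    simp only [sub_self, zero_mul, add_zero]
    refine iff_of_true hφ.2 ?_
    exact (le_min (I.slack_zero_nonneg h) h1').trans
      (hconc.min_le_of_mem_Icc (by simp) (by simp) hφ)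
  · have hfb := hfb h1'
    have hab : a < b := by
      by_contra hba
      rw [not_lt] at hba
      have := hconc.min_le_of_mem_Icc (x := 0) (z := b) (by simp) ha ⟨hb.1, hba⟩
      exact absurd ((le_min (I.slack_zero_nonneg h) hfa).trans this) (not_le.2 hfb)
    refine le_secant_root_iff hconc ha.1 hb.2 hfa hab hfb
      (I.affineOn_slack_ratio ha.1 hb.2 fun s hs t ht hst => ?_) (I.slack_zero_nonneg h) hφ
    rcases le_or_gt 0 (I.slack (I.crossing h s t) h) with h2 | h2
    · exact not_lt.2 ((hc s hs t ht).1 h2) hst.1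
    · exact not_lt.2 ((hc s hs t ht).2 h2) hst.2

end OrderingInstance

/-! ### Programs with counted loops -/

namespace RealRAM

/-- Loop programs: the loop `count k m Q` runs `Q` for the values `0, …, T + m - 1` of the counter
`k`, where `T` is the content of cell `0` of array `0` of natural numbers. -/
inductive Code : Type
  | skip
  | write (A : ℕ) (i : IntExpr) (e : RealExpr)
  | seq (Q R : Code)
  | ite (b : Test) (Q R : Code)
  | count (k m : ℕ) (Q : Code)

/-- The first cell of an array of natural numbers. -/
abbrev counter (k : ℕ) : IntExpr := .read k (.const 0)

namespace Code

/-- The program of a loop program. -/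
def toProgram : Code → Program
  | skip => .skip
  | write A i e => .writeReal A i e
  | seq Q R => .seq Q.toProgram R.toProgram
  | ite b Q R => .cond b Q.toProgram R.toProgram
  | count k m Q => .seq (.writeInt k (.const 0) (.const 0))
      (.loop (.not (.intLe (.add (counter 0) (.const m)) (counter k)))
        (.seq Q.toProgram (.writeInt k (.const 0) (.add (counter k) (.const 1)))))

open Classical in
/-- The effect of a loop program. -/
noncomputable def exec (T : ℕ) : Code → State → State
  | skip, s => s
  | write A i e, s => s.setReal A (i.eval s) (e.eval s)
  | seq Q R, s => R.exec T (Q.exec T s)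
  | ite b Q R, s => if b.Holds s then Q.exec T s else R.exec T s
  | count k m Q, s =>
      Nat.rec (s.setInt k 0 0) (fun i s' => (Q.exec T s').setInt k 0 (i + 1)) (T + m)

theorem exec_skip (T : ℕ) (s : State) : skip.exec T s = s := rfl

theorem exec_write (T A : ℕ) (i : IntExpr) (e : RealExpr) (s : State) :
    (write A i e).exec T s = s.setReal A (i.eval s) (e.eval s) := rfl

theorem exec_seq (T : ℕ) (Q R : Code) (s : State) :
    (seq Q R).exec T s = R.exec T (Q.exec T s) := rfl

theorem exec_ite_pos (T : ℕ) {b : Test} (Q R : Code) {s : State} (h : b.Holds s) :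
    (ite b Q R).exec T s = Q.exec T s := if_pos h

theorem exec_ite_neg (T : ℕ) {b : Test} (Q R : Code) {s : State} (h : ¬b.Holds s) :
    (ite b Q R).exec T s = R.exec T s := if_neg h

/-- The nesting depth of the loops. -/
def depth : Code → ℕ
  | skip => 0
  | write _ _ _ => 0
  | seq Q R => max Q.depth R.depth
  | ite _ Q R => max Q.depth R.depth
  | count _ _ Q => Q.depth + 1

/-- The factor in the bound of the running time. -/
def factor : Code → ℕ
  | skip => 1
  | write _ i e => i.cost + e.cost + 1
  | seq Q R => Q.factor + R.factor
  | ite b Q R => b.cost + Q.factor + R.factor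
  -- Each pass costs `8` for the test and `6` for the increment besides the body; initializing the
  -- counter costs `3` and the final failing test `8`.
  | count _ m Q => (m + 1) * (Q.factor + 14) + 11

/-- The loop counters. -/
def counters : Code → List ℕ
  | skip => []
  | write _ _ _ => []
  | seq Q R => Q.counters ++ R.counters
  | ite _ Q R => Q.counters ++ R.counters
  | count k _ Q => k :: Q.counters

/-- The arrays of real numbers that are written. -/
def writes : Code → List ℕ
  | skip => []
  | write A _ _ => [A]
  | seq Q R => Q.writes ++ R.writes
  | ite _ Q R => Q.writes ++ R.writes
  | count _ _ Q => Q.writes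

/-- No loop changes its own counter or the cell that holds `T`. -/
def WellFormed : Code → Prop
  | skip => True
  | write _ _ _ => True
  | seq Q R => Q.WellFormed ∧ R.WellFormed
  | ite _ Q R => Q.WellFormed ∧ R.WellFormed
  | count k _ Q => k ≠ 0 ∧ k ∉ Q.counters ∧ Q.WellFormed

/-- Reduces every claim that a piece of code leaves an array alone to membership in a concrete list.
-/
theorem exec_frame (T : ℕ) (Q : Code) (s : State) :
    (∀ A ∉ Q.writes, (Q.exec T s).reals A = s.reals A) ∧
      ∀ k ∉ Q.counters, (Q.exec T s).ints k = s.ints k := by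
  induction Q generalizing s with
  | skip => exact ⟨fun _ _ => rfl, fun _ _ => rfl⟩
  | write A i e =>
    refine ⟨fun B hB => ?_, fun k _ => rfl⟩
    simp only [writes, List.mem_singleton] at hB
    simp [exec, State.setReal, hB]
  | seq Q R ihQ ihR =>
    refine ⟨fun B hB => ?_, fun k hk => ?_⟩
    · simp only [writes, List.mem_append, not_or] at hB
      exact ((ihR _).1 B hB.2).trans ((ihQ _).1 B hB.1)
    · simp only [counters, List.mem_append, not_or] at hk
      exact ((ihR _).2 k hk.2).trans ((ihQ _).2 k hk.1)
  | ite b Q R ihQ ihR =>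
    refine ⟨fun B hB => ?_, fun k hk => ?_⟩
    · simp only [writes, List.mem_append, not_or] at hB
      simp only [exec]
      split_ifs
      · exact (ihQ _).1 B hB.1
      · exact (ihR _).1 B hB.2
    · simp only [counters, List.mem_append, not_or] at hk
      simp only [exec]
      split_ifs
      · exact (ihQ _).2 k hk.1
      · exact (ihR _).2 k hk.2
  | count k m Q ih =>
    simp only [exec, writes, counters, List.mem_cons, not_or]
    induction T + m with
    | zero => exact ⟨fun B _ => rfl, fun l hl => by simp [State.setInt, hl.1]⟩
    | succ n ihn =>
      refine ⟨fun B hB => ((ih _).1 B hB).trans (ihn.1 B hB), fun l hl => ?_⟩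
      refine Eq.trans ?_ (((ih _).2 l hl.2).trans (ihn.2 l hl))
      simp [State.setInt, hl.1]

theorem zero_notMem_counters {Q : Code} (hQ : Q.WellFormed) : 0 ∉ Q.counters := by
  induction Q with
  | skip => simp [counters]
  | write A i e => simp [counters]
  | seq Q R ihQ ihR => simp [counters, ihQ hQ.1, ihR hQ.2]
  | ite b Q R ihQ ihR => simp [counters, ihQ hQ.1, ihR hQ.2]
  | count k m Q ih => simp [counters, ih hQ.2.2, hQ.1.symm]

/-- Induction on the number `j` of remaining passes, with the counter at `i`. The body preserves
both the counter and the bound, so the test fails exactly after `T + m` passes in all. -/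
theorem runs_loop {T k m B : ℕ} {Q : Code} (hk0 : k ≠ 0) (hk : k ∉ Q.counters)
    (hQ0 : 0 ∉ Q.counters)
    (hQ : ∀ s : State, s.ints 0 0 = T → ∃ n ≤ B, Runs Q.toProgram s (Q.exec T s) n)
    (j i : ℕ) (hij : i + j = T + m) (s : State) (hT : s.ints 0 0 = T) (hs : s.ints k 0 = i) :
    ∃ n ≤ j * (B + 14) + 8,
      Runs (.loop (.not (.intLe (.add (counter 0) (.const m)) (counter k)))
        (.seq Q.toProgram (.writeInt k (.const 0) (.add (counter k) (.const 1))))) s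
        (Nat.rec s (fun l s' => (Q.exec T s').setInt k 0 (i + l + 1)) j) n := by
  induction j generalizing i s with
  | zero =>
    refine ⟨8, by omega, Runs.loopFalse ?_⟩
    simp only [Test.Holds, IntExpr.eval, hT, hs]
    omega
  | succ j ih =>
    obtain ⟨n, hn, hr⟩ := hQ s hT
    have hc : (Q.exec T s).ints k 0 = i := by rw [(exec_frame T Q s).2 k hk, hs]
    have hc0 : (Q.exec T s).ints 0 0 = T := by rw [(exec_frame T Q s).2 0 hQ0, hT]
    obtain ⟨n', hn', hr'⟩ := ih (i + 1) (by omega) ((Q.exec T s).setInt k 0 (i + 1))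
      (by simp [State.setInt, hk0.symm, hc0]) (by simp [State.setInt])
    refine ⟨8 + (n + 6) + n', by linarith, ?_⟩
    have hw := Runs.writeInt (Q.exec T s) k (.const 0) (.add (counter k) (.const 1))
    simp only [IntExpr.eval, hc] at hw
    have hb : (Test.not (.intLe (.add (counter 0) (.const m)) (counter k))).Holds s := by
      simp only [Test.Holds, IntExpr.eval, hT, hs]
      omega
    have := Runs.loopTrue hb (Runs.seq hr hw) hr'
    -- The operational semantics peels off the first pass, the recursor the last one; this shift
    -- reconciles them.
    have he : ∀ l, (Nat.rec ((Q.exec T s).setInt k 0 (i + 1))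
        (fun l s' => (Q.exec T s').setInt k 0 (i + 1 + l + 1)) l : State) =
        Nat.rec s (fun l s' => (Q.exec T s').setInt k 0 (i + l + 1)) (l + 1) := by
      intro l
      induction l with
      | zero => rfl
      | succ l ihl =>
        simp only at ihl ⊢
        rw [ihl, show i + 1 + l + 1 = i + (l + 1) + 1 by omega]
    rw [he] at this
    exact this

/-- A loop program runs in polynomial time. -/
theorem runs_toProgram {T : ℕ} (hT1 : 1 ≤ T) {Q : Code} (hQ : Q.WellFormed) (s : State)
    (hT : s.ints 0 0 = T) :
    ∃ n ≤ Q.factor * T ^ Q.depth, Runs Q.toProgram s (Q.exec T s) n := by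
  induction Q generalizing s with
  | skip => exact ⟨1, by simp [factor, depth], Runs.skip s⟩
  | write A i e => exact ⟨_, by simp [factor, depth], Runs.writeReal s A i e⟩
  | seq Q R ihQ ihR =>
    obtain ⟨n, hn, h⟩ := ihQ hQ.1 s hT
    obtain ⟨n', hn', h'⟩ := ihR hQ.2 (Q.exec T s)
      (by rw [(exec_frame T Q s).2 0 (zero_notMem_counters hQ.1), hT])
    refine ⟨n + n', ?_, h.seq h'⟩
    rw [factor, depth, add_mul]
    gcongr
    · exact hn.trans (Nat.mul_le_mul_left _ (Nat.pow_le_pow_right hT1 (le_max_left _ _)))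
    · exact hn'.trans (Nat.mul_le_mul_left _ (Nat.pow_le_pow_right hT1 (le_max_right _ _)))
  | ite b Q R ihQ ihR =>
    have h1 := Nat.mul_le_mul_left Q.factor (Nat.pow_le_pow_right hT1 (le_max_left Q.depth R.depth))
    have h2 := Nat.mul_le_mul_left R.factor (Nat.pow_le_pow_right hT1 (le_max_right Q.depth R.depth))
    have h3 : b.cost ≤ b.cost * T ^ max Q.depth R.depth :=
      Nat.le_mul_of_pos_right _ (Nat.pow_pos hT1)
    by_cases hb : b.Holds s
    · obtain ⟨n, hn, h⟩ := ihQ hQ.1 s hT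
      refine ⟨b.cost + n, ?_, ?_⟩
      · rw [factor, depth, add_mul, add_mul]
        omega
      · rw [exec, if_pos hb]
        exact Runs.condTrue hb h
    · obtain ⟨n, hn, h⟩ := ihR hQ.2 s hT
      refine ⟨b.cost + n, ?_, ?_⟩
      · rw [factor, depth, add_mul, add_mul]
        omega
      · rw [exec, if_neg hb]
        exact Runs.condFalse hb h
  | count k m Q ih =>
    obtain ⟨hk0, hk, hwf⟩ := hQ
    obtain ⟨n, hn, h⟩ := runs_loop (m := m) hk0 hk (zero_notMem_counters hwf) (ih hwf) (T + m) 0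
      (by omega) (s.setInt k 0 0) (by simp [State.setInt, hk0.symm, hT]) (by simp [State.setInt])
    refine ⟨3 + n, ?_, ?_⟩
    · have hp : 1 ≤ T ^ Q.depth := Nat.one_le_pow _ _ hT1
      have hm : T + m ≤ (m + 1) * T := by nlinarith
      have h4 : Q.factor * T ^ Q.depth + 14 ≤ (Q.factor + 14) * T ^ Q.depth := by nlinarith
      have h5 := Nat.mul_le_mul hm h4
      have h6 : 11 ≤ 11 * T ^ (Q.depth + 1) :=
        Nat.le_mul_of_pos_right _ (Nat.pow_pos hT1)
      rw [factor, depth]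
      calc 3 + n ≤ (m + 1) * T * ((Q.factor + 14) * T ^ Q.depth) + 11 * T ^ (Q.depth + 1) := by
            omega
        _ = _ := by ring
    · have hw := Runs.writeInt s k (.const 0) (.const 0)
      simp only [zero_add] at h
      exact Runs.seq hw h

/-- The principle of loop invariants. -/
theorem exec_count_induction {T k m : ℕ} {Q : Code} {s₀ : State} (Inv : ℕ → State → Prop)
    (h0 : Inv 0 (s₀.setInt k 0 0))
    (step : ∀ i < T + m, ∀ s : State, s.ints k 0 = i →
      (∀ A ∉ Q.writes, s.reals A = s₀.reals A) →
      (∀ l ∉ k :: Q.counters, s.ints l = s₀.ints l) → Inv i s →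
      Inv (i + 1) ((Q.exec T s).setInt k 0 (i + 1))) :
    Inv (T + m) ((count k m Q).exec T s₀) := by
  simp only [exec]
  -- The invariant is strengthened by the counter value and the frame conditions that `step` may
  -- assume.
  suffices H : ∀ n ≤ T + m, ∀ s : State,
      s = Nat.rec (s₀.setInt k 0 0) (fun i s' => (Q.exec T s').setInt k 0 (i + 1)) n →
      s.ints k 0 = n ∧ (∀ A ∉ Q.writes, s.reals A = s₀.reals A) ∧
      (∀ l ∉ k :: Q.counters, s.ints l = s₀.ints l) ∧ Inv n s from (H _ le_rfl _ rfl).2.2.2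
  intro n hn
  induction n with
  | zero =>
    rintro s rfl
    refine ⟨by simp [State.setInt], fun A _ => rfl, fun l hl => ?_, h0⟩
    simp only [List.mem_cons, not_or] at hl
    simp [State.setInt, hl.1]
  | succ n ih =>
    rintro s rfl
    obtain ⟨h1, h2, h3, h4⟩ := ih (by omega) _ rfl
    refine ⟨by simp [State.setInt], fun A hA => ?_, fun l hl => ?_, step n (by omega) _ h1 h2 h3 h4⟩
    · exact ((exec_frame T Q _).1 A hA).trans (h2 A hA)
    · refine Eq.trans ?_ (((exec_frame T Q _).2 l (List.not_mem_of_not_mem_cons hl)).trans (h3 l hl))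
      simp only [List.mem_cons, not_or] at hl
      simp [State.setInt, hl.1]

end Code

@[simp] theorem setReal_ints (s : State) (A i : ℕ) (x : ℝ) : (s.setReal A i x).ints = s.ints := rfl

@[simp] theorem setInt_reals (s : State) (A i n : ℕ) : (s.setInt A i n).reals = s.reals := rfl

theorem setReal_reals (s : State) (A i : ℕ) (x : ℝ) (B j : ℕ) :
    (s.setReal A i x).reals B j = if B = A ∧ j = i then x else s.reals B j := by
  simp only [State.setReal, Function.update_apply]
  split_ifs with h1 h2 h3 <;> simp_all

end RealRAM

/-! ### The algorithm -/

namespace OrderingInstance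

open Finset RobustOrdering

variable (I : OrderingInstance)

/-- `x` is one of the values `f s t`, `t < n`, with `(s, t)` before `(i, j)`. -/
def Visited (n : ℕ) (f : ℕ → ℕ → ℝ) (i j : ℕ) (x : ℝ) : Prop :=
  ∃ s t, t < n ∧ (s < i ∨ s = i ∧ t < j) ∧ f s t = x

theorem not_visited_zero {n : ℕ} {f : ℕ → ℕ → ℝ} {x : ℝ} : ¬Visited n f 0 0 x := by
  rintro ⟨s, t, _, h | ⟨_, h⟩, _⟩ <;> omega

theorem Visited.of_succ {n : ℕ} {f : ℕ → ℕ → ℝ} {i j : ℕ} {x : ℝ} (h : Visited n f i (j + 1) x) :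
    x = f i j ∨ Visited n f i j x := by
  obtain ⟨s, t, ht, h | ⟨rfl, h⟩, rfl⟩ := h
  · exact Or.inr ⟨s, t, ht, Or.inl h, rfl⟩
  · rcases Nat.lt_succ_iff_lt_or_eq.1 h with h | rfl
    · exact Or.inr ⟨s, t, ht, Or.inr ⟨rfl, h⟩, rfl⟩
    · exact Or.inl rfl

theorem Visited.of_row {n : ℕ} {f : ℕ → ℕ → ℝ} {i : ℕ} {x : ℝ} (h : Visited n f (i + 1) 0 x) :
    Visited n f i n x := by
  obtain ⟨s, t, ht, h | ⟨_, h⟩, rfl⟩ := h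
  · exact ⟨s, t, ht, by omega, rfl⟩
  · omega

theorem visited_mk {n : ℕ} {f : ℕ → ℕ → ℝ} {i s t : ℕ} (hs : s < i) (ht : t < n) :
    Visited n f i 0 (f s t) := ⟨s, t, ht, Or.inl hs, rfl⟩

/-- `a` and `b` are the best bracket, among the tested ratios with the property `Q`, of the zero of
the slack at `h`; the slacks at `a` and `b` are `fa` and `fb`. -/
structure Bracket (h : ℝ) (Q : ℝ → Prop) (a fa b fb : ℝ) : Prop where
  a_mem : a ∈ Set.Icc (0 : ℝ) 1
  b_mem : b ∈ Set.Icc (0 : ℝ) 1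
  fa_eq : fa = I.slack a h
  fb_eq : fb = I.slack b h
  fa_nonneg : 0 ≤ I.slack a h
  eq_one : 0 ≤ I.slack 1 h → a = 1 ∧ b = 1
  fb_neg : I.slack 1 h < 0 → I.slack b h < 0
  tested : ∀ x, Q x → (0 ≤ I.slack x h → x ≤ a) ∧ (I.slack x h < 0 → b ≤ x)

variable {I}

theorem slack_nonneg_of_one {h φ : ℝ} (h1 : 0 ≤ I.slack 1 h) (hφ : φ ∈ Set.Icc (0 : ℝ) 1) :
    0 ≤ I.slack φ h :=
  (le_min (I.slack_zero_nonneg h) h1).trans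
    ((I.concaveOn_slack_ratio h).min_le_of_mem_Icc (by simp) (by simp) hφ)

theorem Bracket.anti {h : ℝ} {Q Q' : ℝ → Prop} {a fa b fb : ℝ} (hB : I.Bracket h Q a fa b fb)
    (hQ : ∀ x, Q' x → Q x) : I.Bracket h Q' a fa b fb :=
  { hB with tested := fun x hx => hB.tested x (hQ x hx) }

/-- The four conditionals mirror the updates in `testCrossing`: a ratio with nonnegative slack may
only push `a` to the right, one with negative slack may only push `b` to the left. -/
theorem Bracket.test {h : ℝ} {Q Q' : ℝ → Prop} {a fa b fb φ : ℝ} (hB : I.Bracket h Q a fa b fb)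
    (hφ : φ ∈ Set.Icc (0 : ℝ) 1) (hQ : ∀ x, Q' x → x = φ ∨ Q x) :
    I.Bracket h Q'
      (if 0 ≤ I.slack φ h ∧ a ≤ φ then φ else a)
      (if 0 ≤ I.slack φ h ∧ a ≤ φ then I.slack φ h else fa)
      (if ¬0 ≤ I.slack φ h ∧ φ ≤ b then φ else b)
      (if ¬0 ≤ I.slack φ h ∧ φ ≤ b then I.slack φ h else fb) := by
  by_cases hs : 0 ≤ I.slack φ h
  · have h0 : ∀ x, Q' x → 0 ≤ I.slack x h → x ≤ max φ a := fun x hx hx0 => by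
      rcases hQ x hx with rfl | hq
      · exact le_max_left _ _
      · exact le_max_of_le_right ((hB.tested x hq).1 hx0)
    have h1 : ∀ x, Q' x → I.slack x h < 0 → b ≤ x := fun x hx hx0 => by
      rcases hQ x hx with rfl | hq
      · exact absurd hs (not_le.2 hx0)
      · exact (hB.tested x hq).2 hx0
    simp only [hs, true_and, not_true, false_and, if_false]
    split_ifs with hle
    · exact ⟨hφ, hB.b_mem, rfl, hB.fb_eq, hs,
        fun h1 => ⟨le_antisymm hφ.2 ((hB.eq_one h1).1 ▸ hle), (hB.eq_one h1).2⟩, hB.fb_neg,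
        fun x hx => ⟨fun h2 => (h0 x hx h2).trans (max_le le_rfl hle), h1 x hx⟩⟩
    · exact { hB with tested := fun x hx =>
        ⟨fun h2 => (h0 x hx h2).trans (max_le (le_of_not_ge hle) le_rfl), h1 x hx⟩ }
  · have h0 : ∀ x, Q' x → I.slack x h < 0 → min φ b ≤ x := fun x hx hx0 => by
      rcases hQ x hx with rfl | hq
      · exact min_le_left _ _
      · exact min_le_of_right_le ((hB.tested x hq).2 hx0)
    have h1 : ∀ x, Q' x → 0 ≤ I.slack x h → x ≤ a := fun x hx hx0 => by
      rcases hQ x hx with rfl | hq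
      · exact absurd hx0 hs
      · exact (hB.tested x hq).1 hx0
    simp only [hs, false_and, not_false_eq_true, true_and, if_false]
    split_ifs with hle
    · exact ⟨hB.a_mem, hφ, hB.fa_eq, rfl, hB.fa_nonneg,
        -- If the slack at `1` is nonnegative, no ratio in `[0, 1]` can fail the test.
        fun h1 => absurd (slack_nonneg_of_one h1 hφ) hs, fun _ => not_le.1 hs,
        fun x hx => ⟨h1 x hx, fun h2 => (le_min le_rfl hle).trans (h0 x hx h2)⟩⟩
    · exact { hB with tested := fun x hx =>
        ⟨h1 x hx, fun h2 => (le_min (le_of_not_ge hle) le_rfl).trans (h0 x hx h2)⟩ }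

variable (I) in
/-- `r` is the largest ratio whose slack is nonnegative at the demands with the property `Q`. -/
structure LargestRatio (Q : ℝ → Prop) (r : ℝ) : Prop where
  mem : r ∈ Set.Icc (0 : ℝ) 1
  le_iff : ∀ φ ∈ Set.Icc (0 : ℝ) 1, φ ≤ r ↔ ∀ h, Q h → 0 ≤ I.slack φ h

/-- For one demand the admissible ratios are those up to the root of its slack; imposing one more
demand takes the minimum of the bounds. -/
theorem LargestRatio.test {Q Q' : ℝ → Prop} {r h a fa b fb : ℝ} (hr : I.LargestRatio Q r)
    (hB : I.Bracket h (Visited (I.T + 1) (I.crossing h) (I.T + 1) 0) a fa b fb)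
    (hQ : ∀ x, Q' x ↔ x = h ∨ Q x) :
    I.LargestRatio Q' (min (a + (b - a) * (fa / (fa - fb))) r) := by
  obtain rfl := hB.fa_eq
  obtain rfl := hB.fb_eq
  have key : ∀ φ ∈ Set.Icc (0 : ℝ) 1, _ := fun φ hφ => I.le_root_iff hB.a_mem hB.b_mem hB.fa_nonneg
    hB.eq_one hB.fb_neg (fun s hs t ht => hB.tested _ (visited_mk hs ht)) hφ
  refine ⟨⟨le_min ((key 0 (by simp)).2 (I.slack_zero_nonneg h)) hr.mem.1,
    (min_le_right _ _).trans hr.mem.2⟩, fun φ hφ => ?_⟩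
  rw [le_min_iff, key φ hφ, hr.le_iff φ hφ]
  constructor
  · rintro ⟨h1, h2⟩ x hx
    rcases (hQ x).1 hx with rfl | hx
    · exact h1
    · exact h2 x hx
  · exact fun h1 => ⟨h1 h ((hQ h).2 (Or.inl rfl)), fun x hx => h1 x ((hQ x).2 (Or.inr hx))⟩

end OrderingInstance

namespace RealRAM

open Finset RobustOrdering OrderingInstance

/-! Arrays of real numbers used by the program: `4` unit costs, `5` grid bases, `6` cumulative
largest expenditures, `7` and `8` the lines of the budgets; in their first cells: `10` gain, `11`
and `12` spending, `13` demand, `14` best profit, `15` lower end, `16` ratio, `17` to `20` bracket,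
`21` result, `22` slack. -/

/-- The first cell of an array of real numbers. -/
abbrev scalar (A : ℕ) : RealExpr := .read A (.const 0)

/-- The cell of an array with the index in the counter `k`. -/
abbrev entry (A k : ℕ) : RealExpr := .read A (counter k)

/-- The cell of an array that follows the index in the counter `k`. -/
abbrev nextEntry (A k : ℕ) : RealExpr := .read A (.add (counter k) (.const 1))

namespace Code

/-- Replace a scalar by its minimum with `e`. -/
def capBelow (A : ℕ) (e : RealExpr) : Code :=
  .ite (.realLe e (scalar A)) (.write A (.const 0) e) .skip

/-- Replace a scalar by its maximum with `e`. -/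
def capAbove (A : ℕ) (e : RealExpr) : Code :=
  .ite (.realLe (scalar A) e) (.write A (.const 0) e) .skip

theorem setReal_self (s : State) (A i : ℕ) : s.setReal A i (s.reals A i) = s := by
  simp [State.setReal]

theorem exec_capBelow (T : ℕ) (A : ℕ) (e : RealExpr) (s : State) :
    (capBelow A e).exec T s = s.setReal A 0 (min (e.eval s) (s.reals A 0)) := by
  by_cases h : (Test.realLe e (scalar A)).Holds s
  · rw [capBelow, exec_ite_pos T _ _ h, min_eq_left (show e.eval s ≤ s.reals A 0 from h)]
    rfl
  · rw [capBelow, exec_ite_neg T _ _ h, min_eq_right (le_of_not_ge (show ¬e.eval s ≤ s.reals A 0 from h)), setReal_self]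
    rfl

theorem exec_capAbove (T : ℕ) (A : ℕ) (e : RealExpr) (s : State) :
    (capAbove A e).exec T s = s.setReal A 0 (max (e.eval s) (s.reals A 0)) := by
  by_cases h : (Test.realLe (scalar A) e).Holds s
  · rw [capAbove, exec_ite_pos T _ _ h, max_eq_left (show s.reals A 0 ≤ e.eval s from h)]
    rfl
  · rw [capAbove, exec_ite_neg T _ _ h, max_eq_right (le_of_not_ge (show ¬s.reals A 0 ≤ e.eval s from h)), setReal_self]
    rfl

/-- The gain of the greedy spending. -/
def gainLoop (e b k : RealExpr) : Code :=
  .seq (.write 10 (.const 0) (.const 0)) <| .seq (.write 11 (.const 0) (.const 0)) <|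
  .count 12 0 <|
    .seq (.write 12 (.const 0) (.add (scalar 11) k)) <|
    .seq (capBelow 12 b) <|
    .seq (.write 10 (.const 0) (.add (scalar 10) (.mul e (.sub (scalar 12) (scalar 11))))) <|
    .write 11 (.const 0) (scalar 12)

/-- The expressions need to be right only in states that differ from `s` in the scratch arrays `10`,
`11`, `12`, so one loop serves both the best profit and the slack. -/
theorem gainLoop_spec {T : ℕ} {e b k : RealExpr} {e' b' k' : ℕ → ℝ} {s : State}
    (h : ∀ s' : State, ∀ i < T, s'.ints 12 0 = i →
      (∀ A, A ≠ 10 → A ≠ 11 → A ≠ 12 → s'.reals A = s.reals A) →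
      e.eval s' = e' (i + 1) ∧ b.eval s' = b' (i + 1) ∧ k.eval s' = k' (i + 1)) :
    ((gainLoop e b k).exec T s).reals 10 0 = gain e' b' k' T := by
  simp only [gainLoop, exec_seq, exec_write, RealExpr.eval, IntExpr.eval]
  refine (exec_count_induction (m := 0) (fun i s => s.reals 10 0 = gain e' b' k' i ∧
    s.reals 11 0 = spend b' k' i) ?_ ?_).1
  · simp [setReal_reals, gain, weightedIncrements, spend]
  · intro i hi s₁ hs₁ hr _ hinv
    have hr' : ∀ A, A ≠ 10 → A ≠ 11 → A ≠ 12 → s₁.reals A = s.reals A := by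
      intro A h1 h2 h3
      rw [hr A (by simp [writes, capBelow, h1, h2, h3])]
      funext j
      simp [setReal_reals, h1, h2]
    have hs : ∀ x, ∀ A, A ≠ 10 → A ≠ 11 → A ≠ 12 → (s₁.setReal 12 0 x).reals A = s.reals A := by
      intro x A h1 h2 h3
      rw [← hr' A h1 h2 h3]
      funext j
      simp [setReal_reals, h3]
    have hs' : ∀ x y, ∀ A, A ≠ 10 → A ≠ 11 → A ≠ 12 →
        ((s₁.setReal 12 0 x).setReal 12 0 y).reals A = s.reals A := by
      intro x y A h1 h2 h3
      rw [← hs x A h1 h2 h3]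
      funext j
      simp [setReal_reals, h3]
    -- The body evaluates `k` before the first write to array `12`, `b` after that write, and `e`
    -- after the minimum has been taken.
    have ek := (h s₁ i (by simpa using hi) hs₁ hr').2.2
    have eb := fun x => (h (s₁.setReal 12 0 x) i (by simpa using hi) hs₁ (hs x)).2.1
    have ee := fun x y => (h ((s₁.setReal 12 0 x).setReal 12 0 y) i (by simpa using hi) hs₁
      (hs' x y)).1
    simp only [exec_seq, exec_write, exec_capBelow, RealExpr.eval, IntExpr.eval, setInt_reals, setReal_reals, ek,
      eb, ee, hinv.1, hinv.2, gain, weightedIncrements_succ, spend]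
    simp

/-- The best profit at the demand in a scalar. -/
def profitLoop (A : ℕ) : Code :=
  gainLoop (.sub (scalar 0) (nextEntry 4 12)) (scalar A) (nextEntry 2 12)

/-- The slack at the ratio in the scalar `16`. -/
def slackLoop : Code :=
  .seq (gainLoop (.div (.sub (scalar 0) (nextEntry 4 12)) (nextEntry 4 12))
    (.sub (nextEntry 7 12) (.mul (scalar 16) (nextEntry 8 12)))
    (.mul (nextEntry 4 12) (nextEntry 2 12))) <|
  .write 22 (.const 0) (.sub (scalar 10) (.mul (scalar 16) (scalar 14)))

/-- The lines of the budgets at the demand in the scalar `13`. -/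
def lineLoop : Code :=
  .seq (.write 15 (.const 0) (.read 0 (.const 1))) <|
  .count 17 0 <|
    .seq (capAbove 15 (.sub (scalar 13) (nextEntry 1 17))) <|
    .seq (profitLoop 15) <|
    .seq (.write 7 (.add (counter 17) (.const 1)) (.mul (scalar 0) (scalar 15))) <|
    .write 8 (.add (counter 17) (.const 1)) (scalar 10)

/-- The bracket from the ratios `0` and `1`. -/
def initBracket : Code :=
  .seq (.write 16 (.const 0) (.const 0)) <| .seq slackLoop <|
  .seq (.write 17 (.const 0) (.const 0)) <| .seq (.write 18 (.const 0) (scalar 22)) <|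
  .seq (.write 16 (.const 0) (.const 1)) <| .seq slackLoop <|
  .seq (.write 19 (.const 0) (.const 1)) <| .seq (.write 20 (.const 0) (scalar 22)) <|
  .ite (.realLe (.const 0) (scalar 22))
    (.seq (.write 17 (.const 0) (.const 1)) (.write 18 (.const 0) (scalar 22))) .skip

/-- The test of the crossing of two lines. -/
def testCrossing : Code :=
  .seq (.write 16 (.const 0) (.div (.sub (.sub (entry 7 15) (entry 6 15))
    (.sub (entry 7 16) (entry 6 16))) (.sub (entry 8 15) (entry 8 16)))) <|
  .seq (capBelow 16 (.const 1)) <| .seq (capAbove 16 (.const 0)) <|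
  .seq slackLoop <|
  .seq (.ite (.and (.realLe (.const 0) (scalar 22)) (.realLe (scalar 17) (scalar 16)))
    (.seq (.write 17 (.const 0) (scalar 16)) (.write 18 (.const 0) (scalar 22))) .skip) <|
  .ite (.and (.not (.realLe (.const 0) (scalar 22))) (.realLe (scalar 16) (scalar 19)))
    (.seq (.write 19 (.const 0) (scalar 16)) (.write 20 (.const 0) (scalar 22))) .skip

/-- The test of a demand of the grid. -/
def testDemand : Code :=
  .seq (.write 13 (.const 0) (.add (entry 5 13) (entry 1 14))) <|
  .seq (capBelow 13 (.read 0 (.const 2))) <| .seq (capAbove 13 (.read 0 (.const 1))) <|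
  .seq lineLoop <| .seq (profitLoop 13) <| .seq (.write 14 (.const 0) (scalar 10)) <|
  .seq initBracket <| .seq (.count 15 1 (.count 16 1 testCrossing)) <|
  capBelow 21 (.add (scalar 17) (.mul (.sub (scalar 19) (scalar 17))
    (.div (scalar 18) (.sub (scalar 18) (scalar 20)))))

/-- The test that a day belongs to a phase. -/
def phaseTest : Test :=
  .and (.intLe (.read 1 (counter 10)) (counter 11))
    (.not (.intLe (.read 1 (.add (counter 10) (.const 1))) (counter 11)))

/-- The unit costs. -/
def costLoop : Code :=
  .count 10 0 <| .count 11 1 <|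
    .ite phaseTest (.write 4 (counter 11) (.add (entry 4 11) (nextEntry 3 10))) .skip

/-- The cumulative capacities and largest expenditures. -/
def sumLoop : Code :=
  .seq (.count 11 0 <|
    .seq (.write 5 (.add (counter 11) (.const 1)) (.add (entry 5 11) (nextEntry 2 11))) <|
    .write 6 (.add (counter 11) (.const 1))
      (.add (entry 6 11) (.mul (nextEntry 4 11) (nextEntry 2 11)))) <|
  .seq (.write 5 (.add (counter 0) (.const 1)) (.read 0 (.const 1))) <|
  .write 5 (.add (counter 0) (.const 2)) (.read 0 (.const 2))

/-- The algorithm. -/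
def ratioCode : Code :=
  .seq costLoop <| .seq sumLoop <| .seq (.write 21 (.const 0) (.const 1)) <|
  .seq (.count 13 3 (.count 14 1 testDemand)) <| .write 0 (.const 0) (scalar 21)

theorem wellFormed_ratioCode : ratioCode.WellFormed := by
  simp [ratioCode, costLoop, sumLoop, testDemand, testCrossing, initBracket, lineLoop, slackLoop,
    profitLoop, gainLoop, capBelow, capAbove, WellFormed, counters]

/-! ### Correctness of the algorithm -/

variable {I : OrderingInstance}

/-- The memory holds the data of the instance. -/
structure Holds (I : OrderingInstance) (s : State) : Prop where
  p : s.reals 0 0 = I.p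
  dlo : s.reals 0 1 = I.dlo
  dhi : s.reals 0 2 = I.dhi
  error : ∀ t ≤ I.T, s.reals 1 t = I.errorBound t
  V : ∀ t, 1 ≤ t → t ≤ I.T → s.reals 2 t = I.V t
  cost : ∀ t, 1 ≤ t → t ≤ I.T → s.reals 4 t = I.unitCost t
  base : ∀ j ≤ I.T + 2, s.reals 5 j = I.gridBase j
  spend : ∀ j ≤ I.T, s.reals 6 j = partialSum I.maxSpend j

theorem Holds.congr {s s' : State} (hs : Holds I s)
    (h : ∀ A ∈ [0, 1, 2, 4, 5, 6], s'.reals A = s.reals A) : Holds I s' := by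
  have h0 := h 0 (by simp)
  have h1 := h 1 (by simp)
  have h2 := h 2 (by simp)
  have h4 := h 4 (by simp)
  have h5 := h 5 (by simp)
  have h6 := h 6 (by simp)
  obtain ⟨a, b, c, d, e, f, g, k⟩ := hs
  exact ⟨by rw [h0, a], by rw [h0, b], by rw [h0, c], by rwa [h1], by rwa [h2], by rwa [h4],
    by rwa [h5], by rwa [h6]⟩

/-- The memory holds the lines of the budgets at the demand `h`. -/
structure HoldsLines (I : OrderingInstance) (h : ℝ) (s : State) : Prop where
  base : ∀ t ≤ I.T, s.reals 7 t = I.lineBase h t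
  slope : ∀ t ≤ I.T, s.reals 8 t = I.lineSlope h t

theorem HoldsLines.congr {h : ℝ} {s s' : State} (hs : HoldsLines I h s)
    (h7 : s'.reals 7 = s.reals 7) (h8 : s'.reals 8 = s.reals 8) : HoldsLines I h s' :=
  ⟨by rw [h7]; exact hs.base, by rw [h8]; exact hs.slope⟩

theorem profitLoop_spec {s : State} (hs : Holds I s) {A : ℕ} (h10 : A ≠ 10) (h11 : A ≠ 11)
    (h12 : A ≠ 12) : ((profitLoop A).exec I.T s).reals 10 0 = I.bestProfit (s.reals A 0) := by
  refine gainLoop_spec fun s' i hi hk hr => ?_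
  have h0 := hr 0 (by simp) (by simp) (by simp)
  have h2 := hr 2 (by simp) (by simp) (by simp)
  have h4 := hr 4 (by simp) (by simp) (by simp)
  simp only [RealExpr.eval, IntExpr.eval, hk, h0, h2, h4, hr A h10 h11 h12]
  exact ⟨by rw [hs.p, hs.cost _ (by omega) hi]; rfl, trivial, hs.V _ (by omega) hi⟩

theorem slackLoop_spec {s : State} {h : ℝ} (hs : Holds I s) (hl : HoldsLines I h s)
    (h14 : s.reals 14 0 = I.bestProfit h) :
    (slackLoop.exec I.T s).reals 22 0 = I.slack (s.reals 16 0) h := by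
  have hf := exec_frame I.T (gainLoop (.div (.sub (scalar 0) (nextEntry 4 12)) (nextEntry 4 12))
    (.sub (nextEntry 7 12) (.mul (scalar 16) (nextEntry 8 12)))
    (.mul (nextEntry 4 12) (nextEntry 2 12))) s
  simp only [slackLoop, exec_seq, exec_write, setReal_reals, RealExpr.eval, IntExpr.eval, and_self, if_true]
  rw [slack_eq, hf.1 16 (by simp [gainLoop, capBelow, writes]),
    hf.1 14 (by simp [gainLoop, capBelow, writes]), h14]
  congr 1
  refine gainLoop_spec fun s' i hi hk hr => ?_
  have h0 := hr 0 (by simp) (by simp) (by simp)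
  have h2 := hr 2 (by simp) (by simp) (by simp)
  have h4 := hr 4 (by simp) (by simp) (by simp)
  have h7 := hr 7 (by simp) (by simp) (by simp)
  have h8 := hr 8 (by simp) (by simp) (by simp)
  have h16 := hr 16 (by simp) (by simp) (by simp)
  simp only [RealExpr.eval, IntExpr.eval, hk, h0, h2, h4, h7, h8, h16]
  rw [hs.p, hs.cost _ (by omega) hi, hl.base _ hi, hl.slope _ hi, hs.V _ (by omega) hi]
  exact ⟨rfl, rfl, rfl⟩

/-- The loop fills only the cells of days `1, …, T`; the two hypotheses on cell `0` provide the zero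
line of day `0`. -/
theorem lineLoop_spec {s : State} (hs : Holds I s) (h7 : s.reals 7 0 = 0)
    (h8 : s.reals 8 0 = 0) : HoldsLines I (s.reals 13 0) (lineLoop.exec I.T s) := by
  set h := s.reals 13 0 with hh
  suffices H : (lineLoop.exec I.T s).reals 15 0 = I.lowerEnd h I.T ∧
      (∀ t ≤ I.T, (lineLoop.exec I.T s).reals 7 t = I.lineBase h t) ∧
      ∀ t ≤ I.T, (lineLoop.exec I.T s).reals 8 t = I.lineSlope h t from ⟨H.2.1, H.2.2⟩
  simp only [lineLoop, exec_seq, exec_write, RealExpr.eval, IntExpr.eval]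
  refine exec_count_induction (m := 0) (fun i s => s.reals 15 0 = I.lowerEnd h i ∧
    (∀ t ≤ i, s.reals 7 t = I.lineBase h t) ∧ ∀ t ≤ i, s.reals 8 t = I.lineSlope h t) ?_ ?_
  · simp [setReal_reals, h7, h8, lineBase, lineSlope, lowerEnd, hs.dlo]
  · intro i hi s₁ hk hr _ ⟨h1, h2, h3⟩
    have hi : i < I.T := hi
    simp only [setInt_reals, exec_seq, exec_write, exec_capAbove]
    set s₂ := s₁.setReal 15 0 (max ((RealExpr.sub (scalar 13) (nextEntry 1 17)).eval s₁)
      (s₁.reals 15 0)) with hs₂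
    have hs₁ : ∀ A ∈ [0, 1, 2, 4, 5, 6, 13], s₁.reals A = s.reals A := by
      intro A hA
      rw [hr A (by
        simp only [writes, capAbove, profitLoop, gainLoop, capBelow]
        revert A
        decide)]
      funext j
      rw [setReal_reals, if_neg]
      rintro ⟨rfl, -⟩
      simp at hA
    have hs₂' : Holds I s₂ := hs.congr fun A hA => by
      rw [← hs₁ A (by simp at hA ⊢; omega)]
      funext j
      rw [hs₂, setReal_reals, if_neg]
      rintro ⟨rfl, -⟩
      simp at hA
    have h15 : s₂.reals 15 0 = I.lowerEnd h (i + 1) := by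
      have h13 := hs₁ 13 (by simp)
      have h01 := hs₁ 1 (by simp)
      simp only [hs₂, setReal_reals, RealExpr.eval, IntExpr.eval, hk, h13, h01, and_self, if_true]
      rw [hs.error _ hi, h1, errorBound, if_neg (by omega), max_comm]
      rfl
    have hf := exec_frame I.T (profitLoop 15) s₂
    have hp := profitLoop_spec hs₂' (A := 15) (by simp) (by simp) (by simp)
    have f0 := hf.1 0 (by simp [profitLoop, gainLoop, capBelow, writes])
    have f7 := hf.1 7 (by simp [profitLoop, gainLoop, capBelow, writes])
    have f8 := hf.1 8 (by simp [profitLoop, gainLoop, capBelow, writes])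
    have f15 := hf.1 15 (by simp [profitLoop, gainLoop, capBelow, writes])
    have f17 := hf.2 17 (by simp [profitLoop, gainLoop, capBelow, counters])
    have g17 : s₂.ints 17 0 = i := hk
    have g7 : s₂.reals 7 = s₁.reals 7 := by funext j; simp [hs₂, setReal_reals]
    have g8 : s₂.reals 8 = s₁.reals 8 := by funext j; simp [hs₂, setReal_reals]
    rw [h15] at hp
    simp only [setReal_reals, setReal_ints, RealExpr.eval, IntExpr.eval, f0, f7, f8, f15, f17, g17,
      g7, g8, hp, h15, hs₂'.p]
    refine ⟨by simp, fun t ht => ?_, fun t ht => ?_⟩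
    · rcases eq_or_ne t (i + 1) with rfl | hne
      · simp [lineBase]
      · simp [hne, h2 t (by omega)]
    · rcases eq_or_ne t (i + 1) with rfl | hne
      · simp [lineSlope]
      · simp [hne, h3 t (by omega)]

theorem Holds.setReal {s : State} (hs : Holds I s) {A : ℕ} (hA : A ∉ [0, 1, 2, 4, 5, 6]) (i : ℕ)
    (x : ℝ) : Holds I (s.setReal A i x) :=
  hs.congr fun B hB => by
    funext j
    rw [setReal_reals, if_neg]
    rintro ⟨rfl, -⟩
    exact hA hB

theorem Holds.exec {s : State} (hs : Holds I s) {T : ℕ} {Q : Code}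
    (hQ : ∀ A ∈ [0, 1, 2, 4, 5, 6], A ∉ Q.writes) : Holds I (Q.exec T s) :=
  hs.congr fun B hB => (exec_frame T Q s).1 B (hQ B hB)

/-- The memory holds the lines of the budgets and the best profit at the demand `h`. -/
structure HoldsDemand (I : OrderingInstance) (h : ℝ) (s : State) : Prop where
  toHolds : Holds I s
  lines : HoldsLines I h s
  best : s.reals 14 0 = I.bestProfit h

theorem HoldsDemand.setReal {h : ℝ} {s : State} (hs : HoldsDemand I h s) {A : ℕ}
    (hA : A ∉ [0, 1, 2, 4, 5, 6, 7, 8, 14]) (i : ℕ) (x : ℝ) :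
    HoldsDemand I h (s.setReal A i x) := by
  have hr : ∀ B ∈ [0, 1, 2, 4, 5, 6, 7, 8, 14], (s.setReal A i x).reals B = s.reals B := by
    intro B hB
    funext j
    rw [setReal_reals, if_neg]
    rintro ⟨rfl, -⟩
    exact hA hB
  refine ⟨hs.toHolds.congr fun B hB => hr B (by simp at hB ⊢; omega),
    hs.lines.congr (hr 7 (by simp)) (hr 8 (by simp)), ?_⟩
  rw [hr 14 (by simp), hs.best]

theorem HoldsDemand.exec {h : ℝ} {s : State} (hs : HoldsDemand I h s) {T : ℕ} {Q : Code}
    (hQ : ∀ A ∈ [0, 1, 2, 4, 5, 6, 7, 8, 14], A ∉ Q.writes) : HoldsDemand I h (Q.exec T s) := by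
  have hr := fun B hB => (exec_frame T Q s).1 B (hQ B hB)
  refine ⟨hs.toHolds.congr fun B hB => hr B (by simp at hB ⊢; omega),
    hs.lines.congr (hr 7 (by simp)) (hr 8 (by simp)), ?_⟩
  rw [hr 14 (by simp), hs.best]

theorem initBracket_spec {s : State} {h : ℝ} (hs : HoldsDemand I h s) {Q : ℝ → Prop}
    (hQ : ∀ x, ¬Q x) : I.Bracket h Q ((initBracket.exec I.T s).reals 17 0)
      ((initBracket.exec I.T s).reals 18 0) ((initBracket.exec I.T s).reals 19 0)
      ((initBracket.exec I.T s).reals 20 0) := by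
  simp only [initBracket, exec_seq, exec_write, RealExpr.eval, IntExpr.eval]
  have hw : ∀ A ∈ [0, 1, 2, 4, 5, 6, 7, 8, 14], A ∉ slackLoop.writes := by
    simp [slackLoop, gainLoop, capBelow, writes]
  set s₁ := s.setReal 16 0 ((0 : ℚ) : ℝ) with hs₁
  have h₁ : HoldsDemand I h s₁ := hs.setReal (by simp) _ _
  have v₁ := slackLoop_spec h₁.toHolds h₁.lines h₁.best
  have h₂ : HoldsDemand I h (slackLoop.exec I.T s₁) := h₁.exec hw
  set s₂ := slackLoop.exec I.T s₁
  set s₃ := ((s₂.setReal 17 0 ((0 : ℚ) : ℝ)).setReal 18 0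
    ((s₂.setReal 17 0 ((0 : ℚ) : ℝ)).reals 22 0)).setReal 16 0 ((1 : ℚ) : ℝ) with hs₃
  have h₃ : HoldsDemand I h s₃ :=
    ((h₂.setReal (by simp) _ _).setReal (by simp) _ _).setReal (by simp) _ _
  have v₃ := slackLoop_spec h₃.toHolds h₃.lines h₃.best
  have f := exec_frame I.T slackLoop s₃
  have f17 := f.1 17 (by simp [slackLoop, gainLoop, capBelow, writes])
  have f18 := f.1 18 (by simp [slackLoop, gainLoop, capBelow, writes])
  set s₄ := slackLoop.exec I.T s₃
  have e1 : s₂.reals 22 0 = I.slack 0 h := by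
    rw [v₁]
    simp [hs₁, setReal_reals]
  have e2 : s₄.reals 22 0 = I.slack 1 h := by
    rw [v₃]
    simp [hs₃, setReal_reals]
  have e3 : s₄.reals 17 0 = 0 := by
    rw [f17]
    simp [hs₃, setReal_reals]
  have e4 : s₄.reals 18 0 = I.slack 0 h := by
    rw [f18, ← e1]
    simp [hs₃, setReal_reals]
  set s₅ := (s₄.setReal 19 0 ((1 : ℚ) : ℝ)).setReal 20 0
    ((s₄.setReal 19 0 ((1 : ℚ) : ℝ)).reals 22 0) with hs₅
  have e5 : s₅.reals 22 0 = I.slack 1 h := by simp [hs₅, setReal_reals, e2]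
  by_cases hb : 0 ≤ I.slack 1 h
  · rw [exec_ite_pos _ _ _ (by simpa [Test.Holds, RealExpr.eval, IntExpr.eval, e5] using hb)]
    simp only [exec_seq, exec_write, RealExpr.eval, IntExpr.eval, hs₅, setReal_reals, e2]
    norm_num
    exact ⟨by simp, by simp, rfl, rfl, hb, by simp, fun h => absurd hb (not_le.2 h),
      fun x hx => absurd hx (hQ x)⟩
  · rw [exec_ite_neg _ _ _ (by simpa [Test.Holds, RealExpr.eval, IntExpr.eval, e5] using hb)]
    simp only [exec_skip, hs₅, setReal_reals, e2, e3, e4]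
    norm_num
    exact ⟨by simp, by simp, rfl, rfl, I.slack_zero_nonneg h, fun h => absurd h hb,
      fun h => h, fun x hx => absurd hx (hQ x)⟩

theorem testCrossing_spec {s : State} {h : ℝ} (hs : HoldsDemand I h s) {i j : ℕ}
    (hi : s.ints 15 0 = i) (hj : s.ints 16 0 = j) (hiT : i < I.T + 1) (hjT : j < I.T + 1)
    {Q Q' : ℝ → Prop}
    (hB : I.Bracket h Q (s.reals 17 0) (s.reals 18 0) (s.reals 19 0) (s.reals 20 0))
    (hQ : ∀ x, Q' x → x = I.crossing h i j ∨ Q x) :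
    I.Bracket h Q' ((testCrossing.exec I.T s).reals 17 0)
      ((testCrossing.exec I.T s).reals 18 0) ((testCrossing.exec I.T s).reals 19 0)
      ((testCrossing.exec I.T s).reals 20 0) := by
  simp only [testCrossing, exec_seq, exec_write, exec_capBelow, exec_capAbove]
  generalize hx₁ : RealExpr.eval s _ = x₁
  simp only [RealExpr.eval, IntExpr.eval, hi, hj, hs.toHolds.spend i (by omega),
    hs.toHolds.spend j (by omega), hs.lines.base i (by omega), hs.lines.base j (by omega),
    hs.lines.slope i (by omega), hs.lines.slope j (by omega)] at hx₁
  set s₂ := s.setReal 16 (IntExpr.eval s (.const 0)) x₁ with hs₂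
  set s₃ := s₂.setReal 16 0 (min (RealExpr.eval s₂ (.const 1)) (s₂.reals 16 0)) with hs₃
  set s₄ := s₃.setReal 16 0 (max (RealExpr.eval s₃ (.const 0)) (s₃.reals 16 0)) with hs₄
  have h₄ : HoldsDemand I h s₄ :=
    ((hs.setReal (by simp) _ _).setReal (by simp) _ _).setReal (by simp) _ _
  have v₄ := slackLoop_spec h₄.toHolds h₄.lines h₄.best
  have f := fun A hA => (exec_frame I.T slackLoop s₄).1 A hA
  have e16 : s₄.reals 16 0 = I.crossing h i j := by
    simp [hs₄, hs₃, hs₂, setReal_reals, RealExpr.eval, IntExpr.eval, crossing, clamp, hx₁]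
  have g : ∀ A, A ≠ 16 → s₄.reals A = s.reals A := by
    intro A hA
    funext l
    simp [hs₄, hs₃, hs₂, setReal_reals, hA]
  have f16 := f 16 (by simp [slackLoop, gainLoop, capBelow, writes])
  have f17 := f 17 (by simp [slackLoop, gainLoop, capBelow, writes])
  have f18 := f 18 (by simp [slackLoop, gainLoop, capBelow, writes])
  have f19 := f 19 (by simp [slackLoop, gainLoop, capBelow, writes])
  have f20 := f 20 (by simp [slackLoop, gainLoop, capBelow, writes])
  rw [g _ (by simp)] at f17 f18 f19 f20
  rw [e16] at v₄
  set s₅ := slackLoop.exec I.T s₄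
  rw [← f17, ← f18, ← f19, ← f20] at hB
  have hφ := I.crossing_mem h i j
  have hT := hB.test hφ hQ
  rw [← e16, ← f16] at hT
  rw [← e16, ← f16] at v₄
  rw [← v₄] at hT
  by_cases h1 : 0 ≤ s₅.reals 22 0
  -- A nonnegative slack disables the second conditional, whether or not the first has moved the
  -- left end.
  · have n2 : ∀ s' : State, s'.reals 22 = s₅.reals 22 →
        ¬(Test.and (.not (.realLe (.const 0) (scalar 22))) (.realLe (scalar 16) (scalar 19))).Holds
          s' := by
      intro s' h'
      simp [Test.Holds, RealExpr.eval, IntExpr.eval, h', h1]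
    by_cases h2 : s₅.reals 17 0 ≤ s₅.reals 16 0
    · rw [exec_ite_pos (s := s₅) _ _ _ (by simp [Test.Holds, RealExpr.eval, IntExpr.eval, h1, h2]),
        exec_ite_neg _ _ _ (n2 _ (by
          funext l
          simp [exec_seq, exec_write, setReal_reals]))]
      simpa [exec_seq, exec_write, exec_skip, setReal_reals, RealExpr.eval, IntExpr.eval, h1, h2]
        using hT
    · rw [exec_ite_neg (s := s₅) _ _ _ (by simp [Test.Holds, RealExpr.eval, IntExpr.eval, h2]), exec_skip,
        exec_ite_neg _ _ _ (n2 _ rfl)]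
      simpa [exec_skip, h1, h2] using hT
  · rw [exec_ite_neg (s := s₅) _ _ _ (by simp [Test.Holds, RealExpr.eval, IntExpr.eval, h1])]
    by_cases h2 : s₅.reals 16 0 ≤ s₅.reals 19 0
    · rw [exec_ite_pos _ _ _ (by
        simpa [exec_skip, Test.Holds, RealExpr.eval, IntExpr.eval, h2] using h1)]
      simpa [exec_seq, exec_write, exec_skip, setReal_reals, RealExpr.eval, IntExpr.eval, h1, h2]
        using hT
    · rw [exec_ite_neg _ _ _ (by
        simp [exec_skip, Test.Holds, RealExpr.eval, IntExpr.eval, h2])]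
      simpa [exec_skip, h1, h2] using hT

theorem crossingLoop_spec {s : State} {h : ℝ} (hs : HoldsDemand I h s)
    (hB : I.Bracket h (fun _ => False) (s.reals 17 0) (s.reals 18 0) (s.reals 19 0)
      (s.reals 20 0)) {s' : State} (hs' : s' = (count 15 1 (count 16 1 testCrossing)).exec I.T s) :
    I.Bracket h (Visited (I.T + 1) (I.crossing h) (I.T + 1) 0) (s'.reals 17 0) (s'.reals 18 0)
      (s'.reals 19 0) (s'.reals 20 0) := by
  have hw : ∀ A ∈ [0, 1, 2, 4, 5, 6, 7, 8, 14], A ∉ testCrossing.writes := by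
    simp [testCrossing, slackLoop, gainLoop, capBelow, capAbove, writes]
  have hcongr : ∀ s₁ s₂ : State, HoldsDemand I h s₁ →
      (∀ A ∉ testCrossing.writes, s₂.reals A = s₁.reals A) → HoldsDemand I h s₂ := by
    intro s₁ s₂ h₁ hr
    refine ⟨h₁.toHolds.congr fun A hA => hr A (hw A (by simp at hA ⊢; omega)),
      h₁.lines.congr (hr 7 (hw 7 (by simp))) (hr 8 (hw 8 (by simp))), ?_⟩
    rw [hr 14 (hw 14 (by simp)), h₁.best]
  rw [hs']
  refine exec_count_induction (m := 1) (fun i s => I.Bracket h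
    (Visited (I.T + 1) (I.crossing h) i 0) (s.reals 17 0) (s.reals 18 0) (s.reals 19 0)
    (s.reals 20 0)) (hB.anti fun x hx => not_visited_zero hx) ?_
  intro i hi s₁ hk hr _ hinv
  -- The end of row `i` in the double loop is the beginning of row `i + 1`.
  refine Bracket.anti ?_ fun x hx => hx.of_row
  refine exec_count_induction (m := 1) (fun j s => I.Bracket h
    (Visited (I.T + 1) (I.crossing h) i j) (s.reals 17 0) (s.reals 18 0) (s.reals 19 0)
    (s.reals 20 0)) hinv ?_
  intro j hj s₂ hk₂ hr₂ hi₂ hinv₂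
  have h₂ : HoldsDemand I h s₂ := hcongr _ _ (hcongr _ _ hs hr) hr₂
  refine testCrossing_spec h₂ ?_ hk₂ hi hj hinv₂ fun x hx => hx.of_succ
  rw [hi₂ 15 (by simp [testCrossing, slackLoop, gainLoop, capBelow, capAbove, counters]), hk]

/-- The first two conclusions restore what `lineLoop` needs when the next demand is tested. -/
theorem testDemand_spec {s : State} (hs : Holds I s) (h7 : s.reals 7 0 = 0)
    (h8 : s.reals 8 0 = 0) {i j : ℕ} (hi : s.ints 13 0 = i) (hj : s.ints 14 0 = j)
    (hiT : i < I.T + 3) (hjT : j < I.T + 1) {Q Q' : ℝ → Prop}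
    (hr : I.LargestRatio Q (s.reals 21 0)) (hQ : ∀ x, Q' x ↔ x = I.gridPoint i j ∨ Q x) :
    (testDemand.exec I.T s).reals 7 0 = 0 ∧ (testDemand.exec I.T s).reals 8 0 = 0 ∧
      I.LargestRatio Q' ((testDemand.exec I.T s).reals 21 0) := by
  simp only [testDemand, exec_seq, exec_write, exec_capBelow, exec_capAbove]
  generalize hx₁ : RealExpr.eval s _ = x₁
  simp only [RealExpr.eval, IntExpr.eval, hi, hj, hs.base i (by omega), hs.error j (by omega)]
    at hx₁
  set s₂ := s.setReal 13 (IntExpr.eval s (.const 0)) x₁ with hs₂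
  set s₃ := s₂.setReal 13 0 (min (RealExpr.eval s₂ (.read 0 (.const 2))) (s₂.reals 13 0)) with hs₃
  set s₄ := s₃.setReal 13 0 (max (RealExpr.eval s₃ (.read 0 (.const 1))) (s₃.reals 13 0)) with hs₄
  have h₄ : Holds I s₄ := ((hs.setReal (by simp) _ _).setReal (by simp) _ _).setReal (by simp) _ _
  have e13 : s₄.reals 13 0 = I.gridPoint i j := by
    simp [hs₄, hs₃, hs₂, setReal_reals, RealExpr.eval, IntExpr.eval, gridPoint, clamp, hx₁,
      hs.dlo, hs.dhi]
  have g : ∀ A, A ≠ 13 → s₄.reals A = s.reals A := by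
    intro A hA
    funext l
    simp [hs₄, hs₃, hs₂, setReal_reals, hA]
  have hl := lineLoop_spec h₄ (by rw [g 7 (by simp), h7]) (by rw [g 8 (by simp), h8])
  rw [e13] at hl
  set h := I.gridPoint i j
  have h₅ : Holds I (lineLoop.exec I.T s₄) := h₄.exec (by
    simp [lineLoop, profitLoop, gainLoop, capBelow, capAbove, writes])
  have f₅ := (exec_frame I.T lineLoop s₄).1
  have f13 := f₅ 13 (by simp [lineLoop, profitLoop, gainLoop, capBelow, capAbove, writes])
  have f21 := f₅ 21 (by simp [lineLoop, profitLoop, gainLoop, capBelow, capAbove, writes])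
  set s₅ := lineLoop.exec I.T s₄
  have hp := profitLoop_spec h₅ (A := 13) (by simp) (by simp) (by simp)
  rw [f13, e13] at hp
  have h₆ : Holds I ((profitLoop 13).exec I.T s₅) := h₅.exec (by
    simp [profitLoop, gainLoop, capBelow, writes])
  have f₆ := (exec_frame I.T (profitLoop 13) s₅).1
  have f7' := f₆ 7 (by simp [profitLoop, gainLoop, capBelow, writes])
  have f8' := f₆ 8 (by simp [profitLoop, gainLoop, capBelow, writes])
  have f21' := f₆ 21 (by simp [profitLoop, gainLoop, capBelow, writes])
  set s₆ := (profitLoop 13).exec I.T s₅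
  set s₇ := s₆.setReal 14 (IntExpr.eval s₆ (.const 0)) (RealExpr.eval s₆ (scalar 10)) with hs₇
  have h₇ : HoldsDemand I h s₇ := by
    refine ⟨h₆.setReal (by simp) _ _, (hl.congr f7' f8').congr ?_ ?_, ?_⟩
    · funext l
      simp [hs₇, setReal_reals]
    · funext l
      simp [hs₇, setReal_reals]
    · simp [hs₇, setReal_reals, RealExpr.eval, IntExpr.eval, hp]
  have e21 : s₇.reals 21 = s.reals 21 := by
    rw [← g 21 (by simp), ← f21, ← f21']
    funext l
    simp [hs₇, setReal_reals]
  have hb := initBracket_spec h₇ (Q := fun _ => False) (fun _ h => h)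
  have h₈ : HoldsDemand I h (initBracket.exec I.T s₇) := h₇.exec (by
    simp [initBracket, slackLoop, gainLoop, capBelow, writes])
  have f21'' := (exec_frame I.T initBracket s₇).1 21 (by
    simp [initBracket, slackLoop, gainLoop, capBelow, writes])
  set s₈ := initBracket.exec I.T s₇
  have hc := crossingLoop_spec h₈ hb rfl
  have h₉ : HoldsDemand I h ((count 15 1 (count 16 1 testCrossing)).exec I.T s₈) := h₈.exec (by
    simp [testCrossing, slackLoop, gainLoop, capBelow, capAbove, writes])
  have f21''' := (exec_frame I.T (count 15 1 (count 16 1 testCrossing)) s₈).1 21 (by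
    simp [testCrossing, slackLoop, gainLoop, capBelow, capAbove, writes])
  set s₉ := (count 15 1 (count 16 1 testCrossing)).exec I.T s₈
  rw [← e21, ← f21'', ← f21'''] at hr
  refine ⟨?_, ?_, ?_⟩
  · simp [setReal_reals, h₉.lines.base 0 (Nat.zero_le _), lineBase]
  · simp [setReal_reals, h₉.lines.slope 0 (Nat.zero_le _), lineSlope]
  · have := hr.test hc hQ
    simpa [setReal_reals, RealExpr.eval, IntExpr.eval] using this

theorem costLoop_spec (ε : ℝ) {t : ℕ} (ht : t ≤ I.T) :
    (costLoop.exec I.T (I.input ε)).reals 4 t = I.unitCost t := by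
  set g : ℕ → ℕ → ℝ := fun v t => if (I.input ε).ints 1 v ≤ t ∧ t < (I.input ε).ints 1 (v + 1)
    then (I.input ε).reals 3 (v + 1) else 0 with hg
  have hsum : ∑ v ∈ range I.T, g v t = I.unitCost t := by
    rw [unitCost]
    symm
    refine (sum_congr rfl fun v hv => ?_).trans
      -- Loop bounds are of the form `T + m`, so the phase loop runs past `K ≤ T`; the extra passes
      -- add the zero cells stored after `γ K`.
      (sum_subset (range_mono I.K_le_T) fun v _ hv => ?_)
    · have hv := mem_range.1 hv
      simp [hg, input, hv.le, hv]
    · have hv := mem_range.not.1 hv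
      simp [hg, input, hv]
  rw [← hsum]
  refine exec_count_induction (m := 0)
    (fun v s => ∀ t ≤ I.T, s.reals 4 t = ∑ u ∈ range v, g u t) ?_ ?_ t ht
  · intro t _
    simp [input]
  intro v hv s₁ hk hr hi hinv
  have H : ∀ t ≤ I.T, ((count 11 1 (.ite phaseTest (.write 4 (counter 11)
      (.add (entry 4 11) (nextEntry 3 10))) .skip)).exec I.T s₁).reals 4 t =
      (∑ u ∈ range v, g u t) + if t < I.T + 1 then g v t else 0 := by
    -- Within the pass for phase `v`, exactly the days before `i` have received their term.
    refine exec_count_induction (m := 1) (fun i s => ∀ t ≤ I.T,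
      s.reals 4 t = (∑ u ∈ range v, g u t) + if t < i then g v t else 0) ?_ ?_
    · intro t ht
      simp [hinv t ht]
    intro i _ s₂ hk₂ hr₂ hi₂ hinv₂ t ht
    have e1 : s₂.ints 1 = (I.input ε).ints 1 :=
      (hi₂ 1 (by simp [counters])).trans (hi 1 (by simp [counters]))
    have e3 : s₂.reals 3 = (I.input ε).reals 3 :=
      (hr₂ 3 (by simp [writes])).trans (hr 3 (by simp [writes]))
    have e10 : s₂.ints 10 0 = v := by rw [hi₂ 10 (by simp [counters]), hk]
    have hp : phaseTest.Holds s₂ ↔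
        (I.input ε).ints 1 v ≤ i ∧ i < (I.input ε).ints 1 (v + 1) := by
      simp [phaseTest, Test.Holds, IntExpr.eval, e1, e10, hk₂]
    have h₂ := hinv₂ t ht
    by_cases hb : phaseTest.Holds s₂
    · rw [exec_ite_pos _ _ _ hb]
      have hgv : g v i = (I.input ε).reals 3 (v + 1) := if_pos (hp.1 hb)
      simp only [exec_write, setInt_reals, setReal_reals, RealExpr.eval, IntExpr.eval, hk₂, e10,
        e3, ← hgv]
      rcases eq_or_ne t i with rfl | hne
      · simp [h₂]
      · simp [h₂, hne, show t < i + 1 ↔ t < i by omega]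
    · rw [exec_ite_neg _ _ _ hb]
      have hgv : g v i = 0 := if_neg fun h => hb (hp.2 h)
      simp only [exec_skip, setInt_reals, h₂]
      rcases eq_or_ne t i with rfl | hne
      · simp [hgv]
      · simp [show t < i + 1 ↔ t < i by omega]
  intro t ht
  rw [setInt_reals, H t ht, if_pos (by omega), sum_range_succ]

theorem sumLoop_spec {s : State} (hT : s.ints 0 0 = I.T) (hp : s.reals 0 0 = I.p)
    (hlo : s.reals 0 1 = I.dlo) (hhi : s.reals 0 2 = I.dhi)
    (he : ∀ t ≤ I.T, s.reals 1 t = I.errorBound t)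
    (hV : ∀ t, 1 ≤ t → t ≤ I.T → s.reals 2 t = I.V t)
    (hc : ∀ t, 1 ≤ t → t ≤ I.T → s.reals 4 t = I.unitCost t) (h5 : s.reals 5 0 = 0)
    (h6 : s.reals 6 0 = 0) : Holds I (sumLoop.exec I.T s) := by
  have hf := (exec_frame I.T sumLoop s).1
  have f0 := hf 0 (by simp [sumLoop, writes])
  have f1 := hf 1 (by simp [sumLoop, writes])
  have f2 := hf 2 (by simp [sumLoop, writes])
  have f4 := hf 4 (by simp [sumLoop, writes])
  suffices H : (∀ j ≤ I.T + 2, (sumLoop.exec I.T s).reals 5 j = I.gridBase j) ∧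
      ∀ j ≤ I.T, (sumLoop.exec I.T s).reals 6 j = partialSum I.maxSpend j by
    exact ⟨by rw [f0, hp], by rw [f0, hlo], by rw [f0, hhi], by rwa [f1], by rwa [f2], by rwa [f4],
      H.1, H.2⟩
  simp only [sumLoop, exec_seq, exec_write]
  set Q : Code := .count 11 0 <|
    .seq (.write 5 (.add (counter 11) (.const 1)) (.add (entry 5 11) (nextEntry 2 11))) <|
    .write 6 (.add (counter 11) (.const 1))
      (.add (entry 6 11) (.mul (nextEntry 4 11) (nextEntry 2 11))) with hQ
  have H : (∀ j ≤ I.T, (Q.exec I.T s).reals 5 j = partialSum I.V j) ∧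
      ∀ j ≤ I.T, (Q.exec I.T s).reals 6 j = partialSum I.maxSpend j := by
    refine exec_count_induction (m := 0) (fun i s => (∀ j ≤ i, s.reals 5 j = partialSum I.V j) ∧
      ∀ j ≤ i, s.reals 6 j = partialSum I.maxSpend j) ?_ ?_
    · simp [h5, h6, partialSum_zero]
    intro i hi s₁ hk hr _ ⟨h1, h2⟩
    have hi : i < I.T := hi
    have e2 := hr 2 (by simp [writes])
    have e4 := hr 4 (by simp [writes])
    simp only [exec_seq, exec_write, setInt_reals, setReal_reals, setReal_ints, RealExpr.eval,
      IntExpr.eval, hk, e2, e4, hV _ (Nat.succ_pos i) hi, hc _ (Nat.succ_pos i) hi, h1 i le_rfl,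
      h2 i le_rfl]
    refine ⟨fun j hj => ?_, fun j hj => ?_⟩
    · rcases eq_or_ne j (i + 1) with rfl | hne
      · simp [partialSum_succ]
      · simp [hne, h1 j (by omega)]
    · rcases eq_or_ne j (i + 1) with rfl | hne
      · simp [partialSum_succ, maxSpend]
      · simp [hne, h2 j (by omega)]
  have f := exec_frame I.T Q s
  have g0 := f.1 0 (by simp [hQ, writes])
  have gT : (Q.exec I.T s).ints 0 0 = I.T := by rw [f.2 0 (by simp [hQ, counters]), hT]
  simp only [setReal_reals, setReal_ints, RealExpr.eval, IntExpr.eval, g0, gT, hlo, hhi]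
  refine ⟨fun j hj => ?_, fun j hj => ?_⟩
  · rw [gridBase]
    rcases Nat.lt_or_ge I.T j with hlt | hle
    · rcases eq_or_ne j (I.T + 1) with rfl | hne
      · simp
      · obtain rfl : j = I.T + 2 := by omega
        simp
    · simp [hle, H.1 j hle, show j ≠ I.T + 1 by omega, show j ≠ I.T + 2 by omega]
  · simp [H.2 j hj]

theorem demandLoop_spec {s : State} (hs : Holds I s) (h7 : s.reals 7 0 = 0)
    (h8 : s.reals 8 0 = 0) (h21 : s.reals 21 0 = 1) :
    I.LargestRatio (Visited (I.T + 1) I.gridPoint (I.T + 3) 0)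
      (((count 13 3 (count 14 1 testDemand)).exec I.T s).reals 21 0) := by
  have hw : ∀ A ∈ [0, 1, 2, 4, 5, 6], A ∉ testDemand.writes := by
    simp [testDemand, initBracket, lineLoop, profitLoop, testCrossing, slackLoop, gainLoop,
      capBelow, capAbove, writes]
  have hvis : ∀ i x,
      Visited (I.T + 1) I.gridPoint (i + 1) 0 x ↔ Visited (I.T + 1) I.gridPoint i (I.T + 1) x := by
    refine fun i x => ⟨Visited.of_row, ?_⟩
    rintro ⟨u, t, ht, hu, rfl⟩
    exact ⟨u, t, ht, Or.inl (by omega), rfl⟩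
  refine (exec_count_induction (m := 3) (fun i s => s.reals 7 0 = 0 ∧ s.reals 8 0 = 0 ∧
    I.LargestRatio (Visited (I.T + 1) I.gridPoint i 0) (s.reals 21 0)) ?_ ?_).2.2
  · simp only [setInt_reals, h7, h8, h21, true_and]
    -- With no demand tested yet, the largest admissible ratio is the initial value `1`.
    exact ⟨by simp, fun φ hφ => iff_of_true hφ.2 fun x hx => absurd hx not_visited_zero⟩
  intro i hi s₁ hk hr _ hinv
  rw [setInt_reals, show Visited (I.T + 1) I.gridPoint (i + 1) 0 =
    Visited (I.T + 1) I.gridPoint i (I.T + 1) from funext fun x => propext (hvis i x)]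
  refine exec_count_induction (m := 1) (fun j s => s.reals 7 0 = 0 ∧ s.reals 8 0 = 0 ∧
    I.LargestRatio (Visited (I.T + 1) I.gridPoint i j) (s.reals 21 0)) hinv ?_
  intro j hj s₂ hk₂ hr₂ hi₂ hinv₂
  have h₂ : Holds I s₂ := (hs.congr fun A hA => hr A (hw A hA)).congr fun A hA => hr₂ A (hw A hA)
  refine testDemand_spec h₂ hinv₂.1 hinv₂.2.1 ?_ hk₂ hi hj hinv₂.2.2 fun x => ⟨Visited.of_succ, ?_⟩
  · rw [hi₂ 13 (by simp [testDemand, initBracket, lineLoop, profitLoop, testCrossing, slackLoop,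
      gainLoop, capBelow, capAbove, counters]), hk]
  · rintro (rfl | ⟨u, t, ht, hu, rfl⟩)
    · exact ⟨i, j, hj, Or.inr ⟨rfl, Nat.lt_succ_self j⟩, rfl⟩
    · exact ⟨u, t, ht, by omega, rfl⟩

/-- The algorithm computes the optimal robust ratio. -/
theorem ratioCode_spec (I : OrderingInstance) (ε : ℝ) :
    I.optimalRatio = ((ratioCode.exec I.T (I.input ε)).output : EReal) := by
  have f₁ := exec_frame I.T costLoop (I.input ε)
  have h₂ : Holds I (sumLoop.exec I.T (costLoop.exec I.T (I.input ε))) := by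
    refine sumLoop_spec ?_ ?_ ?_ ?_ (fun t ht => ?_) (fun t h1 ht => ?_)
      (fun t _ ht => costLoop_spec ε ht) ?_ ?_
    · rw [f₁.2 0 (by simp [costLoop, counters])]
      rfl
    · rw [f₁.1 0 (by simp [costLoop, writes])]
      rfl
    · rw [f₁.1 0 (by simp [costLoop, writes])]
      rfl
    · rw [f₁.1 0 (by simp [costLoop, writes])]
      rfl
    · rw [f₁.1 1 (by simp [costLoop, writes]), errorBound]
      rcases Nat.eq_zero_or_pos t with rfl | h
      · simp [input]
      · simp [input, ht, Nat.succ_le_of_lt h, h.ne']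
    · rw [f₁.1 2 (by simp [costLoop, writes])]
      simp [input, h1, ht]
    · rw [f₁.1 5 (by simp [costLoop, writes])]
      rfl
    · rw [f₁.1 6 (by simp [costLoop, writes])]
      rfl
  have f₂ := exec_frame I.T sumLoop (costLoop.exec I.T (I.input ε))
  have e7 : (sumLoop.exec I.T (costLoop.exec I.T (I.input ε))).reals 7 0 = 0 := by
    rw [f₂.1 7 (by simp [sumLoop, writes]), f₁.1 7 (by simp [costLoop, writes])]
    rfl
  have e8 : (sumLoop.exec I.T (costLoop.exec I.T (I.input ε))).reals 8 0 = 0 := by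
    rw [f₂.1 8 (by simp [sumLoop, writes]), f₁.1 8 (by simp [costLoop, writes])]
    rfl
  simp only [ratioCode, exec_seq, exec_write, RealExpr.eval, IntExpr.eval]
  set s₂ := sumLoop.exec I.T (costLoop.exec I.T (I.input ε))
  have hr := demandLoop_spec (h₂.setReal (A := 21) (by simp) 0 ((1 : ℚ) : ℝ))
    (by simp [setReal_reals, e7]) (by simp [setReal_reals, e8]) (by simp [setReal_reals])
  set s₄ := (count 13 3 (count 14 1 testDemand)).exec I.T (s₂.setReal 21 0 ((1 : ℚ) : ℝ))
  have ho : (s₄.setReal 0 0 (s₄.reals 21 0)).output = s₄.reals 21 0 := by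
    simp [State.output, setReal_reals]
  rw [ho]
  refine optimalRatio_eq hr.mem.1 hr.mem.2 fun φ hφ => ?_
  rw [hr.le_iff φ hφ]
  constructor
  -- Passing the finitely many grid tests gives nonnegative slack on the whole interval; the
  -- converse holds as grid points lie in it.
  · exact fun h => I.slack_nonneg_of_grid fun j hj t ht => h _ (visited_mk hj ht)
  · rintro h _ ⟨j, t, _, _, rfl⟩
    exact h _ (I.gridPoint_mem j t)

end Code

end RealRAM

/-- One real RAM program computes, for every instance and every accuracy `ε > 0`, the optimal
robust competitive ratio up to `ε`, in time `T ^ O(ζ / ε)`. -/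
theorem mainTheorem9 :
    ∃ (P : RealRAM.Program) (C : ℝ), ∀ (I : OrderingInstance) (ε : ℝ), 0 < ε →
      ∃ (s : RealRAM.State) (n : ℕ),
        RealRAM.Runs P (I.input ε) s n ∧
        (n : ℝ) ≤ (max (I.T : ℝ) 2) ^ (C * max 1 (I.zeta / ε)) ∧
        ∃ Φ : ℝ, I.optimalRatio = (Φ : EReal) ∧ |s.output - Φ| ≤ ε := by
  set Q := RealRAM.Code.ratioCode
  -- The time is at most `factor * T ^ depth`; the factor is absorbed through `factor ≤ 2 ^ factor`,
  -- whence the base `max T 2`. The output is exact, so its error is `0`.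
  refine ⟨Q.toProgram, (Q.factor + Q.depth : ℕ), fun I ε hε => ?_⟩
  obtain ⟨n, hn, hr⟩ := RealRAM.Code.runs_toProgram I.one_le_T
    RealRAM.Code.wellFormed_ratioCode (I.input ε) rfl
  refine ⟨_, n, hr, ?_, _, RealRAM.Code.ratioCode_spec I ε, by simpa using hε.le⟩
  have h1 : n ≤ max I.T 2 ^ (Q.factor + Q.depth) := by
    refine hn.trans ?_
    rw [pow_add]
    refine Nat.mul_le_mul ?_ (Nat.pow_le_pow_left (le_max_left _ _) _)
    exact Nat.lt_two_pow_self.le.trans (Nat.pow_le_pow_left (le_max_right _ _) _)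
  have h2 : (1 : ℝ) ≤ max (I.T : ℝ) 2 := le_max_of_le_right (by norm_num)
  calc (n : ℝ) ≤ (max (I.T : ℝ) 2) ^ (Q.factor + Q.depth) := by exact_mod_cast h1
    _ = (max (I.T : ℝ) 2) ^ (((Q.factor + Q.depth : ℕ) : ℝ) * 1) := by
      rw [mul_one, Real.rpow_natCast]
    _ ≤ _ := Real.rpow_le_rpow_of_exponent_le h2
      (mul_le_mul_of_nonneg_left (le_max_left _ _) (Nat.cast_nonneg _))
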